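/- Theorem A.1. Let $K$ be a densely defined self-adjoint operator in a complex Hilbert space $\mathcal H$ which is bounded below, and let $E\in\mathbb R$. Let $B$ be a bounded injective operator on $\mathcal H$ with dense range, so that $B^{-1}$ is densely defined and possibly unbounded, and suppose that $K$ satisfies the limiting absorption principle $$\sup_{z\in\mathbb C:\ \operatorname{Re} z=E,\ \operatorname{Im} z\neq0}\big\|B\,(K-z)^{-1}\,\Pi_c(K)\,B\big\|<\infty ,$$ where $\Pi_c(K)$ is the orthogonal projection onto the continuous spectral subspace of $K$, i.e. onto the orthogonal complement of the closed linear span of all eigenvectors of $K$. Let $A_1,A_2$ be bounded operators on $\mathcal H$ such that $A_1B^{-1}$ and $B^{-1}A_2$ are densely defined and bounded. Finally assume $\operatorname{dist}(\sigma_{pp}(K),E)>0$, where $\sigma_{pp}(K)$ is the set of eigenvalues of $K$ (the distance to the empty set being $+\infty$). Let $s>0$ and let $\gamma$ be the closed polygonal curve with vertices $a-\mathrm is,\ E-\mathrm is,\ E+\mathrm is,\ a+\mathrm is$, traversed in this order, where $a=-1+\inf\sigma(K)$; if $a<E$, it traces the boundary of the rectangle $\{z\in\mathbb C:|\operatorname{Im}z|\le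 s,\ \operatorname{Re}z\in[a,E]\}$ once in the counter-clockwise direction. Then $$\oint_\gamma A_1\,(K-z)^{-1}A_2\,\mathrm dz$$ exists as a Bochner integral with respect to the operator norm, and $$A_1\,1_{<E}(K)\,A_2=-\frac1{2\pi\mathrm i}\oint_\gamma A_1\,(K-z)^{-1}A_2\,\mathrm dz ,$$ where $1_{<E}(K)$ is the spectral projection of $K$ for the interval $(-\infty,E)$. -/

import Mathlib

open MeasureTheory
open scoped ENNReal InnerProductSpace

noncomputable section

namespace UnboundedOp

variable {H : Type*} [NormedAddCommGroup H] [InnerProductSpace ℂ H]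

/-! ### Unbounded operators: resolvent, spectrum, eigenvalues -/

/-- `R` is the bounded, everywhere defined two-sided inverse of `K - z : D(K) → H`. -/
structure IsResolventAt (K : H →ₗ.[ℂ] H) (z : ℂ) (R : H →L[ℂ] H) : Prop where
  mem_domain : ∀ y : H, R y ∈ K.domain
  right_inv : ∀ y : H, K ⟨R y, mem_domain y⟩ - z • R y = y
  left_inv : ∀ x : K.domain, R (K x - z • (x : H)) = x

/-- The resolvent set `ρ(K)`. -/
def resolventSet (K : H →ₗ.[ℂ] H) : Set ℂ :=
  {z | ∃ R : H →L[ℂ] H, IsResolventAt K z R}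

open Classical in
/-- The resolvent `(K - z)⁻¹` for `z ∈ ρ(K)` (and the value `0` for `z ∉ ρ(K)`). -/
def resolvent (K : H →ₗ.[ℂ] H) (z : ℂ) : H →L[ℂ] H :=
  if h : ∃ R : H →L[ℂ] H, IsResolventAt K z R then h.choose else 0

/-- The spectrum of `K`, as a set of real numbers (all of the spectrum if `K` is self-adjoint). -/
def realSpectrum (K : H →ₗ.[ℂ] H) : Set ℝ :=
  {t | (t : ℂ) ∉ resolventSet K}

/-- `K` is bounded below: `⟨x, K x⟩ ≥ c ‖x‖²` on `D(K)` for some real `c`. -/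
def IsBoundedBelow (K : H →ₗ.[ℂ] H) : Prop :=
  ∃ c : ℝ, ∀ x : K.domain, c * ‖(x : H)‖ ^ 2 ≤ RCLike.re ⟪(x : H), K x⟫_ℂ

/-- The point spectrum: the set of (real) eigenvalues of `K`. -/
def pointSpectrum (K : H →ₗ.[ℂ] H) : Set ℝ :=
  {t | ∃ x : K.domain, (x : H) ≠ 0 ∧ K x = (t : ℂ) • (x : H)}

/-- The pure point subspace: the closed linear span of all eigenvectors of `K`. -/
def purePointSubspace (K : H →ₗ.[ℂ] H) : Submodule ℂ H :=
  (Submodule.span ℂ {v : H | ∃ (t : ℝ) (x : K.domain), (x : H) = v ∧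
    K x = (t : ℂ) • (x : H)}).topologicalClosure

/-! ### Products with the inverse of a weight -/

/-- The inverse of an injective bounded operator `B`, an unbounded operator with domain `ran B`. -/
def inverseOp (B : H →L[ℂ] H) :
    H →ₗ.[ℂ] H :=
  ((B : H →ₗ[ℂ] H).toPMap ⊤).inverse

/-- `‖A B⁻¹‖ < ∞`: the operator `A B⁻¹`, defined on `D(B⁻¹) = ran B`, is bounded. -/
def IsBoundedMulInverse (A B : H →L[ℂ] H) : Prop :=
  ∃ C : ℝ, ∀ y : (inverseOp B).domain, ‖A (inverseOp B y)‖ ≤ C * ‖(y : H)‖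

/-- `‖B⁻¹ A‖ < ∞`: the operator `B⁻¹ A`, with its natural domain `{x | A x ∈ D(B⁻¹)}`, is densely
defined and bounded. -/
def IsBoundedInverseMul (B A : H →L[ℂ] H) : Prop :=
  Dense {x : H | A x ∈ (inverseOp B).domain} ∧
    ∃ C : ℝ, ∀ (x : H) (hx : A x ∈ (inverseOp B).domain), ‖inverseOp B ⟨A x, hx⟩‖ ≤ C * ‖x‖

/-! ### Contour integrals along the boundary of a rectangle -/

/-- `f` is Bochner integrable along each of the four sides of the rectangle
`{z : a ≤ Re z ≤ b, |Im z| ≤ s}`. -/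
def RectContourIntegrable {F : Type*} [NormedAddCommGroup F] [NormedSpace ℂ F]
    (f : ℂ → F) (a b s : ℝ) : Prop :=
  IntervalIntegrable (fun x : ℝ => f (x - s * Complex.I)) volume a b ∧
  IntervalIntegrable (fun y : ℝ => f (b + y * Complex.I)) volume (-s) s ∧
  IntervalIntegrable (fun x : ℝ => f (x + s * Complex.I)) volume a b ∧
  IntervalIntegrable (fun y : ℝ => f (a + y * Complex.I)) volume (-s) s

/-- The integral `∮ f(z) dz` along the closed polygon
`a - is → b - is → b + is → a + is → a - is`. -/
def rectContourIntegral {F : Type*} [NormedAddCommGroup F] [NormedSpace ℂ F]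
    (f : ℂ → F) (a b s : ℝ) : F :=
  (∫ x : ℝ in a..b, f (x - s * Complex.I)) +
  Complex.I • (∫ y : ℝ in (-s)..s, f (b + y * Complex.I)) -
  (∫ x : ℝ in a..b, f (x + s * Complex.I)) -
  Complex.I • (∫ y : ℝ in (-s)..s, f (a + y * Complex.I))

variable [CompleteSpace H]

/-- `Π_c(K)`: the orthogonal projection onto the continuous spectral subspace, which is the
orthogonal complement of the pure point subspace. -/
def continuousProjection (K : H →ₗ.[ℂ] H) : H →L[ℂ] H :=
  haveI : CompleteSpace (purePointSubspace K) :=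
    (Submodule.isClosed_topologicalClosure _).completeSpace_coe
  (purePointSubspace K)ᗮ.starProjection

/-! ### Spectral measures -/

/-- A projection-valued measure on the Borel sets of `ℝ`. The values at non-measurable sets are
irrelevant. -/
structure ProjectionValuedMeasure (H : Type*) [NormedAddCommGroup H] [InnerProductSpace ℂ H]
    [CompleteSpace H] where
  /-- The projection attached to a Borel set. -/
  proj : Set ℝ → H →L[ℂ] H
  isStarProjection : ∀ s, MeasurableSet s → IsStarProjection (proj s)
  univ : proj Set.univ = 1
  inter : ∀ s t, MeasurableSet s → MeasurableSet t → proj (s ∩ t) = proj s ∘L proj t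
  iUnion : ∀ f : ℕ → Set ℝ, (∀ i, MeasurableSet (f i)) → Pairwise (fun i j => Disjoint (f i) (f j)) →
    ∀ x : H, HasSum (fun i => proj (f i) x) (proj (⋃ i, f i) x)

namespace ProjectionValuedMeasure

variable (P : ProjectionValuedMeasure H)

theorem empty_apply (x : H) : P.proj ∅ x = 0 := by
  have h := P.iUnion (fun _ => ∅) (fun _ => MeasurableSet.empty) (fun i j _ => disjoint_bot_left) x
  exact tendsto_nhds_unique (tendsto_const_nhds (x := P.proj ∅ x)) h.summable.tendsto_atTop_zero

theorem re_inner_nonneg {s : Set ℝ} (hs : MeasurableSet s) (x : H) :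
    0 ≤ RCLike.re ⟪x, P.proj s x⟫_ℂ := by
  have h := P.isStarProjection s hs
  have h1 : P.proj s x = P.proj s (P.proj s x) :=
    (congrArg (fun T : H →L[ℂ] H => T x) h.isIdempotentElem.eq).symm
  have h2 : ContinuousLinearMap.adjoint (P.proj s) = P.proj s := h.isSelfAdjoint
  rw [h1, ← ContinuousLinearMap.adjoint_inner_left, h2]
  exact inner_self_nonneg

/-- The finite Borel measure `μ_x(s) = ⟨x, P(s) x⟩`. -/
def scalarMeasure (x : H) : Measure ℝ :=
  Measure.ofMeasurable (fun s _ => ENNReal.ofReal (RCLike.re ⟪x, P.proj s x⟫_ℂ))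
    (by simp [empty_apply])
    (by
      intro f hf hd
      have h := (P.iUnion f hf hd x).mapL (RCLike.reCLM.comp
        ((innerSL ℂ x).restrictScalars ℝ))
      have h' : HasSum (fun i => RCLike.re ⟪x, P.proj (f i) x⟫_ℂ)
        (RCLike.re ⟪x, P.proj (⋃ i, f i) x⟫_ℂ) := h
      rw [← h'.tsum_eq]
      exact ENNReal.ofReal_tsum_of_nonneg (fun i => P.re_inner_nonneg (hf i) x) h'.summable)

/-- `P` is the spectral measure of `K`, i.e. `K = ∫ t dP(t)`: the domain of `K` is the set of all
`x` with `∫ t² dμ_x(t) < ∞`, and `⟨x, K x⟩ = ∫ t dμ_x(t)` for all `x ∈ D(K)`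
(which determines `K x` by polarization). -/
structure IsSpectralMeasureOf (K : H →ₗ.[ℂ] H) : Prop where
  mem_domain_iff : ∀ x : H, x ∈ K.domain ↔ Integrable (fun t : ℝ => t ^ 2) (P.scalarMeasure x)
  inner_eq : ∀ x : K.domain,
    ⟪(x : H), K x⟫_ℂ = ((∫ t : ℝ, t ∂(P.scalarMeasure (x : H)) : ℝ) : ℂ)

end ProjectionValuedMeasure

open Classical in
/-- The spectral projection `1_s(K)`: the value at `s` of the spectral measure of `K` (and `0` for
an operator `K` without a spectral measure). -/
def spectralProjection (K : H →ₗ.[ℂ] H) (s : Set ℝ) : H →L[ℂ] H :=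
  if h : ∃ P : ProjectionValuedMeasure H, P.IsSpectralMeasureOf K then h.choose.proj s else 0

/-! ### The limiting absorption principle -/

/-- `sup { ‖B (K - z)⁻¹ Π_c(K) B‖ : Re z = E, Im z ≠ 0 }`, with values in `[0, ∞]`. -/
def limitingAbsorptionSup (K : H →ₗ.[ℂ] H) (B : H →L[ℂ] H) (E : ℝ) : ℝ≥0∞ :=
  ⨆ (z : ℂ) (_ : z.re = E ∧ z.im ≠ 0), ‖B ∘L resolvent K z ∘L continuousProjection K ∘L B‖ₑ

end UnboundedOp

end

noncomputable section

namespace UnboundedOp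

variable {H : Type*} [NormedAddCommGroup H] [InnerProductSpace ℂ H]

/-! ### Resolvents -/

section Resolvent

variable {K : H →ₗ.[ℂ] H} {z w : ℂ}

/-! For a single spectral value `t ≠ E` the formula is Cauchy's: integrating `(t - z)⁻¹` around the
rectangle gives `-2πi` if `t < E` and `0` if `t > E`. The difficulty is that continuous spectrum may
pass through `E`, so the contour can cross it and the resolvent itself need not be integrable there.

The part `|Im z| < ε` of the side `Re z = E` is therefore cut out. On the remaining path the
resolvent is continuous, and by `inner_resolvent_self` and Fubini its quadratic form at `v` is the
integral of the truncated scalar contour integral against the spectral measure `μ_v`. That scalar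
integral is an explicit sum of arctangents, equal to `-2πi 1_{t<E} - 2i arctan(ε/(t-E))` for `t ≠ E`
(`cauchyKernel_truncated`); the point `E` carries no mass because it is not an eigenvalue. The error
is bounded by a constant and tends to zero pointwise, so the truncated contour tends weakly to `-2πi
P(-∞, E)` (`tendsto_inner_truncatedContour`).

Between `A₁` and `A₂`, on the other hand, the resolvent is bounded on the whole line `Re z = E`
(`exists_norm_weighted_resolvent_le`): limiting absorption controls its continuous part, and the gap
between `E` and the eigenvalues controls its pure point part. The full contour integral thus exists
in norm and is the norm limit of the truncated ones. Comparing the two limits proves the theorem.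

The spectral measure is constructed by applying Riesz–Markov to the bounded resolvent at a real
point `l` below the spectrum and pushing forward under `t ↦ t⁻¹ + l`. Its working form is
`scalarMeasure_apply_sub`: the measure of `(K - z)x` is `|t - z|² μ_x`. -/

theorem isResolventAt_resolvent (hz : z ∈ resolventSet K) :
    IsResolventAt K z (resolvent K z) := by
  have h : ∃ R : H →L[ℂ] H, IsResolventAt K z R := hz
  rw [resolvent, dif_pos h]
  exact h.choose_spec

theorem resolvent_mem_domain (hz : z ∈ resolventSet K) (y : H) : resolvent K z y ∈ K.domain :=
  (isResolventAt_resolvent hz).mem_domain y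

/-- The first resolvent identity. -/
theorem resolvent_sub_resolvent (hz : z ∈ resolventSet K) (hw : w ∈ resolventSet K) :
    resolvent K z - resolvent K w = (z - w) • (resolvent K z ∘L resolvent K w) := by
  ext y
  have h := (isResolventAt_resolvent hz).left_inv ⟨_, resolvent_mem_domain hw y⟩
  have h' := (isResolventAt_resolvent hw).right_inv y
  have e : K ⟨_, resolvent_mem_domain hw y⟩ - z • resolvent K w y
      = y - (z - w) • resolvent K w y := by
    rw [sub_eq_iff_eq_add] at h'
    rw [h']; module
  simp only at h
  rw [e, map_sub, map_smul] at h
  rw [sub_eq_iff_eq_add] at h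
  simp [h]

variable [CompleteSpace H]

theorem inner_apply_left (hK : IsSelfAdjoint K) (x y : K.domain) :
    ⟪K x, (y : H)⟫_ℂ = ⟪(x : H), K y⟫_ℂ := by
  have h := LinearPMap.adjoint_isFormalAdjoint hK.dense_domain
  rw [LinearPMap.isSelfAdjoint_def.1 hK] at h
  exact h x y

theorem exists_mem_domain_of_inner (hK : IsSelfAdjoint K) {y w : H}
    (h : ∀ x : K.domain, ⟪w, (x : H)⟫_ℂ = ⟪y, K x⟫_ℂ) :
    ∃ hy : y ∈ K.domain, K ⟨y, hy⟩ = w := by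
  have h1 : y ∈ K.adjoint.domain := LinearPMap.mem_adjoint_domain_of_exists y ⟨w, h⟩
  have h2 := LinearPMap.adjoint_apply_eq hK.dense_domain ⟨y, h1⟩ h
  have h3 := LinearPMap.isSelfAdjoint_def.1 hK
  have key : ∀ L : H →ₗ.[ℂ] H, L = K → ∀ hL : y ∈ L.domain, L ⟨y, hL⟩ = w →
      ∃ hy : y ∈ K.domain, K ⟨y, hy⟩ = w := by
    rintro _ rfl hL e
    exact ⟨hL, e⟩
  exact key _ h3 h1 h2

/-- A self-adjoint operator is closed: the identity defining the adjoint survives both limits. -/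
theorem exists_mem_domain_of_tendsto (hK : IsSelfAdjoint K) {u : ℕ → K.domain} {x y : H}
    (hx : Filter.Tendsto (fun n => (u n : H)) Filter.atTop (nhds x))
    (hy : Filter.Tendsto (fun n => K (u n)) Filter.atTop (nhds y)) :
    ∃ h : x ∈ K.domain, K ⟨x, h⟩ = y := by
  refine exists_mem_domain_of_inner hK fun v => ?_
  have h1 := hy.inner (tendsto_const_nhds (x := (v : H))) (𝕜 := ℂ)
  have h2 := hx.inner (tendsto_const_nhds (x := K v)) (𝕜 := ℂ)
  simp only [inner_apply_left hK] at h1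
  exact tendsto_nhds_unique h1 h2

/-- A vector of `H` which is a limit of vectors in the domain with bounded images is itself in the
domain. -/
theorem mem_domain_of_tendsto_of_bounded (hK : IsSelfAdjoint K) {u : ℕ → K.domain} {x : H}
    (hx : Filter.Tendsto (fun n => (u n : H)) Filter.atTop (nhds x))
    {C : ℝ} (hC : ∀ n, ‖K (u n)‖ ≤ C) : x ∈ K.domain := by
  -- Membership in the adjoint domain only asks that `v ↦ ⟪x, K v⟫` be bounded, and the bound `C`
  -- passes to the limit.
  rw [← LinearPMap.isSelfAdjoint_def.1 hK, LinearPMap.mem_adjoint_domain_iff]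
  refine AddMonoidHomClass.continuous_of_bound _ C fun v => ?_
  have h2 := hx.inner (tendsto_const_nhds (x := K v)) (𝕜 := ℂ)
  refine le_of_tendsto h2.norm (Filter.Eventually.of_forall fun n => ?_)
  rw [← inner_apply_left hK]
  exact (norm_inner_le_norm _ _).trans (mul_le_mul_of_nonneg_right (hC n) (norm_nonneg _))

/-- The lower bound makes `K - z` injective and, as `K` is closed, gives it closed range. The
orthogonal complement of the range is the kernel of `K - z̄`, which `h'` excludes. -/
theorem mem_resolventSet_of_le (hK : IsSelfAdjoint K) {δ : ℝ} (hδ : 0 < δ)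
    (h : ∀ x : K.domain, δ * ‖(x : H)‖ ≤ ‖K x - z • (x : H)‖)
    (h' : ∀ x : K.domain, K x = (starRingEnd ℂ z) • (x : H) → (x : H) = 0) :
    z ∈ resolventSet K := by
  let T : K.domain →ₗ[ℂ] H := K.toFun - z • K.domain.subtype
  have hT : ∀ x, T x = K x - z • (x : H) := fun x => rfl
  have hinj : Function.Injective T := by
    rw [injective_iff_map_eq_zero]
    intro x hx
    have := h x
    rw [← hT, hx, norm_zero] at this
    have h0 : ‖(x : H)‖ = 0 := le_antisymm (by nlinarith) (norm_nonneg _)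
    simpa using h0
  have hclosed : IsClosed (LinearMap.range T : Set H) := by
    refine IsSeqClosed.isClosed fun y p hy hp => ?_
    choose u hu using hy
    have hcau : CauchySeq (fun n => (u n : H)) := by
      rw [Metric.cauchySeq_iff']
      intro ε hε
      obtain ⟨N, hN⟩ := Metric.cauchySeq_iff'.1 hp.cauchySeq (δ * ε) (by positivity)
      refine ⟨N, fun n hn => ?_⟩
      have h1 := hN n hn
      rw [dist_eq_norm, ← hu, ← hu, ← map_sub] at h1
      have h2 := h (u n - u N)
      rw [← hT] at h2
      rw [dist_eq_norm]
      exact lt_of_mul_lt_mul_left (h2.trans_lt h1) hδ.le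
    obtain ⟨x, hx⟩ := cauchySeq_tendsto_of_complete hcau
    have hKu : Filter.Tendsto (fun n => K (u n)) Filter.atTop (nhds (p + z • x)) := by
      have := hp.add (hx.const_smul z)
      refine this.congr fun n => ?_
      rw [← hu, hT]; abel
    obtain ⟨hxd, hKx⟩ := exists_mem_domain_of_tendsto hK hx hKu
    exact ⟨⟨x, hxd⟩, by rw [hT, hKx]; simp⟩
  have hdense : (LinearMap.range T)ᗮ = ⊥ := by
    rw [Submodule.eq_bot_iff]
    intro y hy
    rw [Submodule.mem_orthogonal'] at hy
    obtain ⟨hyd, hKy⟩ := exists_mem_domain_of_inner hK (y := y) (w := starRingEnd ℂ z • y) (by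
      intro x
      have := hy (T x) ⟨x, rfl⟩
      rw [hT, inner_sub_right, inner_smul_right, sub_eq_zero] at this
      rw [inner_smul_left, this]; simp)
    exact h' ⟨y, hyd⟩ hKy
  have hsurj : Function.Surjective T := by
    rw [← LinearMap.range_eq_top]
    have : CompleteSpace (LinearMap.range T) := hclosed.completeSpace_coe
    rwa [Submodule.orthogonal_eq_bot_iff] at hdense
  let e := LinearEquiv.ofBijective T ⟨hinj, hsurj⟩
  have he : ∀ y, T (e.symm y) = y := fun y => e.apply_symm_apply y
  have he' : ∀ x, e.symm (T x) = x := fun x => e.symm_apply_apply x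
  refine ⟨(K.domain.subtype ∘ₗ e.symm.toLinearMap).mkContinuous δ⁻¹ fun y => ?_, ?_, ?_, ?_⟩
  · have := h (e.symm y)
    rw [← hT, he] at this
    rw [inv_mul_eq_div, le_div_iff₀ hδ, mul_comm]
    exact this
  · intro y; exact (e.symm y).2
  · intro y; exact he y
  · intro x
    change ((e.symm (K x - z • (x : H)) : K.domain) : H) = x
    rw [← hT, he']

theorem im_inner_apply_self (hK : IsSelfAdjoint K) (x : K.domain) :
    (⟪(x : H), K x⟫_ℂ).im = 0 := by
  have h := inner_apply_left hK x x
  rw [← inner_conj_symm] at h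
  exact Complex.conj_eq_iff_im.1 h

/-- Since `⟪x, K x⟫` is real, the imaginary part of `⟪x, (K - z) x⟫` is `-Im z ‖x‖²`; Cauchy–Schwarz
does the rest. -/
theorem abs_im_mul_norm_le (hK : IsSelfAdjoint K) (z : ℂ) (x : K.domain) :
    |z.im| * ‖(x : H)‖ ≤ ‖K x - z • (x : H)‖ := by
  have h1 : (⟪(x : H), K x - z • (x : H)⟫_ℂ).im = -(z.im * ‖(x : H)‖ ^ 2) := by
    rw [inner_sub_right, inner_smul_right, inner_self_eq_norm_sq_to_K, Complex.sub_im,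
      im_inner_apply_self hK, zero_sub]
    simp [← Complex.ofReal_pow]
  have h2 := (Complex.abs_im_le_norm _).trans (norm_inner_le_norm (𝕜 := ℂ) (x : H) (K x - z • (x : H)))
  rw [h1, abs_neg, abs_mul, abs_of_nonneg (sq_nonneg ‖(x : H)‖)] at h2
  rcases (norm_nonneg (x : H)).eq_or_lt with h0 | h0
  · rw [← h0]; simp
  · refine le_of_mul_le_mul_left ?_ h0
    linarith

theorem mem_resolventSet_of_im_ne_zero (hK : IsSelfAdjoint K) (hz : z.im ≠ 0) :
    z ∈ resolventSet K := by
  refine mem_resolventSet_of_le hK (abs_pos.2 hz) (abs_im_mul_norm_le hK z) fun x hx => ?_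
  have := abs_im_mul_norm_le hK (starRingEnd ℂ z) x
  rw [hx, sub_self, norm_zero, Complex.conj_im, abs_neg] at this
  have h0 : ‖(x : H)‖ = 0 :=
    le_antisymm (by have := abs_pos.2 hz; nlinarith) (norm_nonneg _)
  simpa using h0

theorem ofReal_mem_resolventSet_of_lt (hK : IsSelfAdjoint K) {c l : ℝ}
    (hc : ∀ x : K.domain, c * ‖(x : H)‖ ^ 2 ≤ RCLike.re ⟪(x : H), K x⟫_ℂ) (hl : l < c) :
    (l : ℂ) ∈ resolventSet K := by
  have key : ∀ x : K.domain, (c - l) * ‖(x : H)‖ ≤ ‖K x - (l : ℂ) • (x : H)‖ := by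
    intro x
    have h1 : (c - l) * ‖(x : H)‖ ^ 2 ≤ RCLike.re ⟪(x : H), K x - (l : ℂ) • (x : H)⟫_ℂ := by
      rw [inner_sub_right, inner_smul_right, inner_self_eq_norm_sq_to_K, map_sub]
      have : RCLike.re ((l : ℂ) * ((‖(x : H)‖ : ℂ)) ^ 2) = l * ‖(x : H)‖ ^ 2 := by
        simp [← Complex.ofReal_pow]
      have h2 := hc x
      erw [this]
      linarith
    have h2 := h1.trans ((RCLike.re_le_norm _).trans (norm_inner_le_norm (𝕜 := ℂ) _ _))
    rcases (norm_nonneg (x : H)).eq_or_lt with h0 | h0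
    · rw [← h0]; simp
    · refine le_of_mul_le_mul_left ?_ h0
      linarith
  refine mem_resolventSet_of_le hK (sub_pos.2 hl) key fun x hx => ?_
  have := key x
  rw [hx, Complex.conj_ofReal, sub_self, norm_zero] at this
  have h0 : ‖(x : H)‖ = 0 := le_antisymm (by have := sub_pos.2 hl; nlinarith) (norm_nonneg _)
  simpa using h0

theorem bddBelow_realSpectrum (hK : IsSelfAdjoint K) (hb : IsBoundedBelow K) :
    BddBelow (realSpectrum K) := by
  obtain ⟨c, hc⟩ := hb
  refine ⟨c, fun t ht => ?_⟩
  by_contra h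
  exact ht (ofReal_mem_resolventSet_of_lt hK hc (not_le.1 h))

/-- For an empty spectrum `sInf` takes the value `0`, and the claim holds trivially. -/
theorem ofReal_mem_resolventSet_of_lt_sInf (hK : IsSelfAdjoint K) (hb : IsBoundedBelow K) {l : ℝ}
    (hl : l < sInf (realSpectrum K)) : (l : ℂ) ∈ resolventSet K := by
  by_contra h
  exact notMem_of_lt_csInf hl (bddBelow_realSpectrum hK hb) h

theorem inner_resolvent_left (hK : IsSelfAdjoint K) (hz : z ∈ resolventSet K)
    (hz' : starRingEnd ℂ z ∈ resolventSet K) (u v : H) :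
    ⟪resolvent K z u, v⟫_ℂ = ⟪u, resolvent K (starRingEnd ℂ z) v⟫_ℂ := by
  have h1 := (isResolventAt_resolvent hz).right_inv u
  have h2 := (isResolventAt_resolvent hz').right_inv v
  set x : K.domain := ⟨_, resolvent_mem_domain hz u⟩
  set y : K.domain := ⟨_, resolvent_mem_domain hz' v⟩
  change ⟪(x : H), v⟫_ℂ = ⟪u, (y : H)⟫_ℂ
  rw [← h1, ← h2, inner_sub_left, inner_sub_right, inner_apply_left hK, inner_smul_left,
    inner_smul_right]

end Resolvent

/-! ### Quadratic forms and weak limits of operators -/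

section WeakLimits

open Filter Topology

theorem clm_ext_inner_self {S T : H →L[ℂ] H} (h : ∀ v, ⟪S v, v⟫_ℂ = ⟪T v, v⟫_ℂ) : S = T := by
  have := (ext_inner_map (S : H →ₗ[ℂ] H) (T : H →ₗ[ℂ] H)).1 h
  ext v
  exact LinearMap.congr_fun this v

/-- The right-hand side of the polarization identity for the form `q v = ⟪T v, v⟫`. -/
def polarForm (q : H → ℂ) (u v : H) : ℂ :=
  (q (u + v) - q (u - v) - Complex.I * q (u + Complex.I • v)
    + Complex.I * q (u - Complex.I • v)) / 4

theorem inner_eq_polarForm (T : H →L[ℂ] H) (u v : H) :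
    ⟪T u, v⟫_ℂ = polarForm (fun w => ⟪T w, w⟫_ℂ) u v :=
  inner_map_polarization' (T : H →ₗ[ℂ] H) u v

theorem tendsto_inner_of_tendsto_inner_self {ι : Type*} {l : Filter ι} {T : ι → H →L[ℂ] H}
    {q : H → ℂ} (h : ∀ v, Tendsto (fun n => ⟪T n v, v⟫_ℂ) l (𝓝 (q v))) (u v : H) :
    Tendsto (fun n => ⟪T n u, v⟫_ℂ) l (𝓝 (polarForm q u v)) := by
  have e : (fun n => ⟪T n u, v⟫_ℂ) = fun n => polarForm (fun w => ⟪T n w, w⟫_ℂ) u v :=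
    funext fun n => inner_eq_polarForm _ _ _
  rw [e]
  exact ((((h _).sub (h _)).sub ((h _).const_mul _)).add ((h _).const_mul _)).div_const _

variable [CompleteSpace H]

/-- The form bounds say `0 ≤ T ≤ 1`, which for a positive operator is equivalent to norm at most
one. -/
theorem norm_le_one_of_inner_self {T : H →L[ℂ] H} {r : H → ℝ}
    (h : ∀ v, ⟪T v, v⟫_ℂ = r v) (h0 : ∀ v, 0 ≤ r v) (h1 : ∀ v, r v ≤ ‖v‖ ^ 2) : ‖T‖ ≤ 1 := by
  have hT : 0 ≤ T := by
    rw [ContinuousLinearMap.nonneg_iff_isPositive, ContinuousLinearMap.isPositive_iff_complex]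
    intro v
    rw [h]
    exact ⟨by simp, by simpa using h0 v⟩
  rw [CStarAlgebra.norm_le_one_iff_of_nonneg T hT, ContinuousLinearMap.le_def,
    ContinuousLinearMap.isPositive_iff_complex]
  intro v
  have : ⟪(1 - T) v, v⟫_ℂ = ((‖v‖ ^ 2 - r v : ℝ) : ℂ) := by
    rw [sub_apply, inner_sub_left, h]
    simp [inner_self_eq_norm_sq_to_K]
  rw [this]
  exact ⟨by rw [RCLike.re_eq_complex_re, Complex.ofReal_re],
    by rw [RCLike.re_eq_complex_re, Complex.ofReal_re]; exact sub_nonneg.2 (h1 v)⟩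

/-- A bounded sequence of operators whose quadratic forms converge has a weak limit. -/
theorem exists_tendsto_inner {T : ℕ → H →L[ℂ] H} (hT : ∀ n, ‖T n‖ ≤ 1) {q : H → ℂ}
    (h : ∀ v, Tendsto (fun n => ⟪T n v, v⟫_ℂ) atTop (𝓝 (q v))) :
    ∃ S : H →L[ℂ] H, ∀ u v, Tendsto (fun n => ⟪T n u, v⟫_ℂ) atTop (𝓝 ⟪S u, v⟫_ℂ) := by
  have hb := tendsto_inner_of_tendsto_inner_self h
  -- Polarization gives convergence off the diagonal; the limit inherits sesquilinearity and the
  -- bound `1`, so it comes from an operator.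
  let B : H →ₗ⋆[ℂ] H →ₗ[ℂ] ℂ := LinearMap.mk₂'ₛₗ (starRingEnd ℂ) (RingHom.id ℂ) (polarForm q)
    (fun u u' v => tendsto_nhds_unique (hb _ _)
      (by simpa only [map_add, inner_add_left] using (hb u v).add (hb u' v)))
    (fun c u v => tendsto_nhds_unique (hb _ _)
      (by simpa only [map_smul, inner_smul_left, smul_eq_mul] using (hb u v).const_mul (starRingEnd ℂ c)))
    (fun u v v' => tendsto_nhds_unique (hb _ _)
      (by simpa only [inner_add_right] using (hb u v).add (hb u v')))
    (fun c u v => tendsto_nhds_unique (hb _ _)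
      (by simpa only [inner_smul_right, smul_eq_mul, RingHom.id_apply] using (hb u v).const_mul c))
  have hB : ∀ u v, ‖B u v‖ ≤ 1 * ‖u‖ * ‖v‖ := by
    intro u v
    refine le_of_tendsto (hb u v).norm (Eventually.of_forall fun n => ?_)
    exact (norm_inner_le_norm _ _).trans (mul_le_mul_of_nonneg_right
      ((T n).le_of_opNorm_le (hT n) u) (norm_nonneg _))
  refine ⟨InnerProductSpace.continuousLinearMapOfBilin (B.mkContinuous₂ 1 hB), fun u v => ?_⟩
  rw [InnerProductSpace.continuousLinearMapOfBilin_apply]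
  exact hb u v

end WeakLimits

/-! ### The spectral measure of a bounded self-adjoint operator -/

section Bounded

open Filter Topology
open scoped CompactlySupported

variable [CompleteSpace H]

/-- `ν v` is the measure representing the functional `f ↦ ⟪f(T) v, v⟫` on continuous functions. -/
structure IsScalarSpectralFamily (T : H →L[ℂ] H) (ν : H → Measure ℝ) : Prop where
  isFiniteMeasure : ∀ v, IsFiniteMeasure (ν v)
  ae_mem : ∀ v, ∀ᵐ t ∂ν v, t ∈ spectrum ℝ T
  inner_eq : ∀ f : ℝ → ℝ, Continuous f → ∀ v, ⟪cfc f T v, v⟫_ℂ = ((∫ t, f t ∂ν v : ℝ) : ℂ)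

/-- Riesz–Markov for the positive functional `f ↦ ⟪f(T) v, v⟫` on the compact spectrum, pushed
forward to the line. -/
theorem exists_isScalarSpectralFamily {T : H →L[ℂ] H} (hT : IsSelfAdjoint T) :
    ∃ ν : H → Measure ℝ, IsScalarSpectralFamily T ν := by
  let X := spectrum ℝ T
  have hpos : ∀ (f : C(X, ℝ)), 0 ≤ f → ∀ v : H, 0 ≤ RCLike.re ⟪cfcHom hT f v, v⟫_ℂ := by
    intro f hf v
    have h1 : 0 ≤ cfcHom hT f := by
      rw [← cfcHom_nonneg_iff hT] at hf
      exact hf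
    rw [ContinuousLinearMap.nonneg_iff_isPositive, ContinuousLinearMap.isPositive_iff_complex] at h1
    exact (h1 v).2
  let Λ : H → C_c(X, ℝ) →ₚ[ℝ] ℝ := fun v => PositiveLinearMap.mk₀
    { toFun := fun f => RCLike.re ⟪cfcHom hT (f : C(X, ℝ)) v, v⟫_ℂ
      map_add' := fun f g => by
        have : ((f + g : C_c(X, ℝ)) : C(X, ℝ)) = (f : C(X, ℝ)) + (g : C(X, ℝ)) := rfl
        rw [this, map_add, add_apply, inner_add_left, map_add]
      map_smul' := fun c f => by
        have : ((c • f : C_c(X, ℝ)) : C(X, ℝ)) = c • (f : C(X, ℝ)) := rfl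
        rw [this, map_smul, smul_apply, inner_smul_left_eq_smul]
        simp }
    (fun f hf => hpos _ hf v)
  have hX : MeasurableSet X := (spectrum.isClosed T (𝕜 := ℝ)).measurableSet
  have hme : MeasurableEmbedding (Subtype.val : X → ℝ) := MeasurableEmbedding.subtype_coe hX
  refine ⟨fun v => (RealRMK.rieszMeasure (Λ v)).map Subtype.val, fun v => inferInstance,
    fun v => ?_, fun f hf v => ?_⟩
  · rw [hme.ae_map_iff]
    exact Eventually.of_forall fun t => t.2
  · rw [hme.integral_map]
    have h1 := RealRMK.integral_rieszMeasure (Λ v)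
      (CompactlySupportedContinuousMap.continuousMapEquiv
        (⟨fun t : X => f t, hf.comp continuous_subtype_val⟩ : C(X, ℝ)))
    change ∫ t : X, f t ∂(RealRMK.rieszMeasure (Λ v)) = RCLike.re ⟪cfcHom hT _ v, v⟫_ℂ at h1
    have h3 : IsSelfAdjoint (cfc f T) := cfc_predicate f T
    rw [h1, cfc_apply f T hT hf.continuousOn] at *
    have h2 := h3.isSymmetric
    exact ((LinearMap.IsSymmetric.coe_re_inner_apply_self h2) v).symm

variable {T : H →L[ℂ] H} {ν : H → Measure ℝ}

theorem IsScalarSpectralFamily.measureReal_univ (hT : IsSelfAdjoint T)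
    (hν : IsScalarSpectralFamily T ν) (v : H) :
    (ν v).real Set.univ = ‖v‖ ^ 2 := by
  have h := hν.inner_eq (fun _ => 1) continuous_const v
  rw [cfc_const_one ℝ T] at h
  simp [inner_self_eq_norm_sq_to_K] at h
  exact_mod_cast h.symm

theorem IsScalarSpectralFamily.integrable (hν : IsScalarSpectralFamily T ν) {f : ℝ → ℝ}
    (hf : Continuous f) (v : H) : Integrable f (ν v) := by
  have := hν.isFiniteMeasure v
  obtain ⟨C, hC⟩ := (spectrum.isCompact T (𝕜 := ℝ)).exists_bound_of_continuousOn hf.continuousOn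
  refine Integrable.of_bound hf.aestronglyMeasurable C ?_
  filter_upwards [hν.ae_mem v] with t ht using hC t ht

theorem inner_cfc_apply_self (f : ℝ → ℝ) (T : H →L[ℂ] H) (u v : H) :
    ⟪cfc f T u, v⟫_ℂ = ⟪u, cfc f T v⟫_ℂ := by
  have h : IsSelfAdjoint (cfc f T) := cfc_predicate f T
  exact h.isSymmetric u v

/-- `⟪f(T) h(T) v, h(T) v⟫ = ⟪(h f h)(T) v, v⟫`, and bounded continuous `f` determine a finite
measure. -/
theorem IsScalarSpectralFamily.cfc_apply_eq_withDensity
    (hν : IsScalarSpectralFamily T ν) {h : ℝ → ℝ} (hh : Continuous h) (v : H) :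
    ν (cfc h T v) = (ν v).withDensity (fun t => ENNReal.ofReal (h t ^ 2)) := by
  have := hν.isFiniteMeasure v
  have := hν.isFiniteMeasure (cfc h T v)
  have hi := hν.integrable (hh.pow 2) v
  have : IsFiniteMeasure ((ν v).withDensity (fun t => ENNReal.ofReal (h t ^ 2))) :=
    isFiniteMeasure_withDensity_ofReal hi.2
  refine ext_of_forall_integral_eq_of_IsFiniteMeasure fun f => ?_
  rw [integral_withDensity_eq_integral_toReal_smul (by fun_prop) (by simp)]
  have h1 := hν.inner_eq f f.continuous (cfc h T v)
  have h2 := hν.inner_eq (fun t => h t * (f t * h t)) (by fun_prop) v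
  rw [cfc_mul h (fun t => f t * h t) T (by fun_prop) (by fun_prop),
    cfc_mul f h T (by fun_prop) (by fun_prop), mul_apply_eq_comp,
    inner_cfc_apply_self, mul_apply_eq_comp, h1] at h2
  have h3 : ∫ t, f t ∂ν (cfc h T v) = ∫ t, h t * (f t * h t) ∂ν v := by exact_mod_cast h2
  rw [h3]
  refine integral_congr_ae (Eventually.of_forall fun t => ?_)
  simp only [ENNReal.toReal_ofReal (sq_nonneg (h t)), smul_eq_mul]
  ring

end Bounded

/-! ### Spectral projections of a bounded self-adjoint operator -/

section Bounded

open Filter Topology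

variable [CompleteSpace H]

variable {T : H →L[ℂ] H} {ν : H → Measure ℝ}

/-- `S` is the operator with quadratic form `v ↦ ν_v(s)`. -/
def Represents (ν : H → Measure ℝ) (s : Set ℝ) (S : H →L[ℂ] H) : Prop :=
  ∀ v, ⟪S v, v⟫_ℂ = (((ν v).real s : ℝ) : ℂ)

omit [CompleteSpace H] in
theorem Represents.unique {s : Set ℝ} {S S' : H →L[ℂ] H} (h : Represents ν s S)
    (h' : Represents ν s S') : S = S' :=
  clm_ext_inner_self fun v => (h v).trans (h' v).symm

theorem Represents.isSelfAdjoint {s : Set ℝ} {S : H →L[ℂ] H} (h : Represents ν s S) :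
    IsSelfAdjoint S := by
  have : S.IsPositive := by
    rw [ContinuousLinearMap.isPositive_iff_complex]
    intro v
    rw [h v, RCLike.re_eq_complex_re, Complex.ofReal_re]
    exact ⟨rfl, measureReal_nonneg⟩
  exact this.isSelfAdjoint

theorem Represents.norm_le_one (hT : IsSelfAdjoint T) (hν : IsScalarSpectralFamily T ν)
    {s : Set ℝ} {S : H →L[ℂ] H} (h : Represents ν s S) : ‖S‖ ≤ 1 :=
  norm_le_one_of_inner_self h (fun _ => measureReal_nonneg) fun v => by
    have := hν.isFiniteMeasure v
    rw [← hν.measureReal_univ hT v]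
    exact measureReal_mono (Set.subset_univ s)

theorem Represents.compl (hT : IsSelfAdjoint T) (hν : IsScalarSpectralFamily T ν)
    {s : Set ℝ} (hs : MeasurableSet s) {S : H →L[ℂ] H} (h : Represents ν s S) :
    Represents ν sᶜ (1 - S) := by
  intro v
  have := hν.isFiniteMeasure v
  rw [measureReal_compl hs, hν.measureReal_univ hT, sub_apply, inner_sub_left, h v]
  simp [inner_self_eq_norm_sq_to_K]

theorem represents_sum (hν : IsScalarSpectralFamily T ν) {f : ℕ → Set ℝ}
    (hf : ∀ i, MeasurableSet (f i)) (hd : Pairwise (Function.onFun Disjoint f))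
    {S : ℕ → H →L[ℂ] H} (h : ∀ i, Represents ν (f i) (S i)) (F : Finset ℕ) :
    Represents ν (⋃ i ∈ F, f i) (∑ i ∈ F, S i) := by
  intro v
  have := hν.isFiniteMeasure v
  rw [measureReal_biUnion_finset (fun i _ j _ hij => hd hij) fun i _ => hf i,
    sum_apply, sum_inner]
  push_cast
  exact Finset.sum_congr rfl fun i _ => h i v

theorem hasSum_measureReal {α : Type*} [MeasurableSpace α] (μ : Measure α) [IsFiniteMeasure μ]
    {f : ℕ → Set α} (hf : ∀ i, MeasurableSet (f i)) (hd : Pairwise (Function.onFun Disjoint f)) :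
    HasSum (fun i => μ.real (f i)) (μ.real (⋃ i, f i)) := by
  have h := measure_iUnion (μ := μ) hd hf
  rw [measureReal_def, h, ENNReal.tsum_toReal_eq fun i => measure_ne_top _ _]
  exact (ENNReal.summable_toReal (by rw [← h]; exact measure_ne_top _ _)).hasSum

theorem tendsto_integral_apprSeq {α : Type*} [TopologicalSpace α] [MeasurableSpace α]
    [BorelSpace α] [HasOuterApproxClosed α] (μ : Measure α) [IsFiniteMeasure μ] {F : Set α}
    (hF : IsClosed F) :
    Tendsto (fun n => ∫ t, (hF.apprSeq n t : ℝ) ∂μ) atTop (𝓝 (μ.real F)) := by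
  have h := HasOuterApproxClosed.tendsto_lintegral_apprSeq hF μ
  have h2 := (ENNReal.tendsto_toReal (measure_ne_top μ F)).comp h
  refine h2.congr fun n => ?_
  rw [Function.comp_apply, integral_eq_lintegral_of_nonneg_ae
    (Eventually.of_forall fun t => NNReal.coe_nonneg _)
    (NNReal.continuous_coe.comp (hF.apprSeq n).continuous).aestronglyMeasurable]
  simp

theorem tendsto_inner_cfc_apprSeq (hν : IsScalarSpectralFamily T ν) {F : Set ℝ}
    (hF : IsClosed F) (v : H) :
    Tendsto (fun n => ⟪cfc (fun t => (hF.apprSeq n t : ℝ)) T v, v⟫_ℂ) atTop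
      (𝓝 (((ν v).real F : ℝ) : ℂ)) := by
  have := hν.isFiniteMeasure v
  have h := (Complex.continuous_ofReal.tendsto _).comp (tendsto_integral_apprSeq (ν v) hF)
  exact h.congr fun n =>
    (hν.inner_eq _ (NNReal.continuous_coe.comp (hF.apprSeq n).continuous) v).symm

/-- Induction over the Borel sets generated by the closed ones. Closed sets and disjoint unions are
reached by weak limits, of continuous functions of `T` and of partial sums respectively; complements
by `1 - S`. Commutation with `T` is carried along because weak limits preserve it and
multiplicativity will need it. -/
theorem exists_represents (hT : IsSelfAdjoint T) (hν : IsScalarSpectralFamily T ν)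
    (s : Set ℝ) (hs : MeasurableSet s) :
    ∃ S : H →L[ℂ] H, Represents ν s S ∧ Commute S T := by
  have weak : ∀ (S : ℕ → H →L[ℂ] H) (s : Set ℝ), (∀ n, ‖S n‖ ≤ 1) → (∀ n, Commute (S n) T) →
      (∀ v, Tendsto (fun n => ⟪S n v, v⟫_ℂ) atTop (𝓝 (((ν v).real s : ℝ) : ℂ))) →
      ∃ S : H →L[ℂ] H, Represents ν s S ∧ Commute S T := by
    intro S s h1 h2 h3
    obtain ⟨S', hS'⟩ := exists_tendsto_inner h1 h3
    refine ⟨S', fun v => tendsto_nhds_unique (hS' v v) (h3 v), ?_⟩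
    ext u
    refine ext_inner_right ℂ fun v => ?_
    rw [mul_apply_eq_comp, mul_apply_eq_comp]
    have e : ⟪T (S' u), v⟫_ℂ = ⟪S' u, T v⟫_ℂ := hT.isSymmetric _ _
    rw [e]
    refine tendsto_nhds_unique (hS' (T u) v) ((hS' u (T v)).congr fun n => ?_)
    have e : ⟪T (S n u), v⟫_ℂ = ⟪S n u, T v⟫_ℂ := hT.isSymmetric _ _
    rw [← e, ← mul_apply_eq_comp, ← mul_apply_eq_comp, (h2 n).eq]
  induction s, hs using MeasurableSpace.induction_on_inter
    ((BorelSpace.measurable_eq (α := ℝ)).trans borel_eq_generateFrom_isClosed)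
    isPiSystem_isClosed with
  | empty => exact ⟨0, fun v => by simp, Commute.zero_left _⟩
  | basic F hF =>
    have hF : IsClosed F := hF
    refine weak (fun n => cfc (fun t => (hF.apprSeq n t : ℝ)) T) F (fun n => ?_) (fun n => ?_)
      (tendsto_inner_cfc_apprSeq hν hF)
    · refine norm_cfc_le zero_le_one fun t _ => ?_
      rw [Real.norm_of_nonneg (NNReal.coe_nonneg _)]
      exact_mod_cast HasOuterApproxClosed.apprSeq_apply_le_one hF n t
    · have := cfc_commute_cfc (fun t => (hF.apprSeq n t : ℝ)) id T
      rwa [cfc_id ℝ T] at this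
  | compl s hs ih =>
    obtain ⟨S, h1, h2⟩ := ih
    exact ⟨1 - S, h1.compl hT hν hs, (Commute.one_left T).sub_left h2⟩
  | iUnion f hd hf ih =>
    choose S h1 h2 using ih
    refine weak (fun n => ∑ i ∈ Finset.range n, S i) _
      (fun n => (represents_sum hν hf hd h1 _).norm_le_one hT hν)
      (fun n => Commute.sum_left _ _ _ fun i _ => h2 i) fun v => ?_
    have := hν.isFiniteMeasure v
    have h := (Complex.continuous_ofReal.tendsto _).comp
      (hasSum_measureReal (ν v) hf hd).tendsto_sum_nat
    refine h.congr fun n => ?_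
    rw [represents_sum hν hf hd h1 _ v,
      measureReal_biUnion_finset (fun i _ j _ hij => hd hij) fun i _ => hf i]
    rfl

/-- With `h = √f`, commutation turns the left side into `⟪S h(T)v, h(T)v⟫`, the mass of `s` under
the measure of `h(T)v`, whose density with respect to `ν v` is `h² = f`. -/
theorem inner_cfc_represents_apply (hν : IsScalarSpectralFamily T ν) {s : Set ℝ}
    (hs : MeasurableSet s) {S : H →L[ℂ] H} (h1 : Represents ν s S) (h2 : Commute S T)
    {f : ℝ → ℝ} (hf : Continuous f) (hf0 : ∀ t, 0 ≤ f t) (v : H) :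
    ⟪cfc f T (S v), v⟫_ℂ = ((∫ t in s, f t ∂ν v : ℝ) : ℂ) := by
  have := hν.isFiniteMeasure v
  set h : ℝ → ℝ := fun t => Real.sqrt (f t)
  have hh : Continuous h := hf.sqrt
  have e : f = fun t => h t * h t := funext fun t => (Real.mul_self_sqrt (hf0 t)).symm
  have hc : Commute S (cfc h T) := (h2.symm.cfc_real h).symm
  have key : ⟪cfc f T (S v), v⟫_ℂ = ⟪S (cfc h T v), cfc h T v⟫_ℂ := by
    rw [e, cfc_mul h h T (by fun_prop) (by fun_prop), mul_apply_eq_comp, inner_cfc_apply_self,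
      ← mul_apply_eq_comp, ← hc.eq, mul_apply_eq_comp]
  rw [key, h1, hν.cfc_apply_eq_withDensity hh, measureReal_def, withDensity_apply _ hs]
  congr 1
  rw [integral_eq_lintegral_of_nonneg_ae (Eventually.of_forall hf0) hf.aestronglyMeasurable]
  simp only [h, Real.sq_sqrt (hf0 _)]

/-- Induction on `t` with `s` fixed. For closed `t` continuous approximations reduce the claim to
`inner_cfc_represents_apply`; taking `s = t` then yields idempotence. -/
theorem Represents.mul (hT : IsSelfAdjoint T) (hν : IsScalarSpectralFamily T ν) {s t : Set ℝ}
    (hs : MeasurableSet s) (ht : MeasurableSet t) {S S' : H →L[ℂ] H} (h1 : Represents ν s S)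
    (h1' : Represents ν t S') (h2 : Commute S T) :
    Represents ν (t ∩ s) (S' * S) := by
  induction t, ht using MeasurableSpace.induction_on_inter
    ((BorelSpace.measurable_eq (α := ℝ)).trans borel_eq_generateFrom_isClosed)
    isPiSystem_isClosed generalizing S' with
  | empty =>
    have : S' = 0 := h1'.unique (fun v => by simp)
    intro v
    simp [this]
  | basic F hF =>
    have hF : IsClosed F := hF
    intro v
    have := hν.isFiniteMeasure v
    -- `S'` is known only through its quadratic form, so the off-diagonal value `⟪S' (S v), v⟫` is
    -- reached by polarization.
    have e1 := tendsto_inner_of_tendsto_inner_self (tendsto_inner_cfc_apprSeq hν hF) (S v) v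
    have e2 : ⟪S' (S v), v⟫_ℂ = polarForm (fun w => (((ν w).real F : ℝ) : ℂ)) (S v) v := by
      rw [inner_eq_polarForm]
      congr 1
      exact funext h1'
    rw [← e2] at e1
    have e3 := (Complex.continuous_ofReal.tendsto _).comp
      (tendsto_integral_apprSeq ((ν v).restrict s) hF)
    rw [mul_apply_eq_comp]
    refine tendsto_nhds_unique e1 ?_
    rw [measureReal_restrict_apply hF.measurableSet] at e3
    exact e3.congr fun n => (inner_cfc_represents_apply hν hs h1 h2
      (NNReal.continuous_coe.comp (hF.apprSeq n).continuous) (fun _ => NNReal.coe_nonneg _) v).symm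
  | compl t ht ih =>
    intro v
    have := hν.isFiniteMeasure v
    have e := ih (S' := 1 - S') (by simpa using h1'.compl hT hν ht.compl) v
    have e2 := h1 v
    rw [sub_mul, one_mul, sub_apply, inner_sub_left, e2] at e
    have e3 : (ν v).real (s ∩ t) + (ν v).real (s \ t) = (ν v).real s :=
      measureReal_inter_add_sdiff ht
    have e4 : ⟪(S' * S) v, v⟫_ℂ = (((ν v).real s : ℝ) : ℂ) - (((ν v).real (t ∩ s) : ℝ) : ℂ) := by
      rw [← e]; ring
    rw [e4, ← e3, Set.inter_comm tᶜ, ← Set.sdiff_eq, Set.inter_comm t]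
    push_cast
    ring
  | iUnion f hd hf ih =>
    choose Q hQ _ using fun i => exists_represents hT hν (f i) (hf i)
    intro v
    have := hν.isFiniteMeasure v
    have e1 : ∀ w, Tendsto (fun n => ⟪(∑ i ∈ Finset.range n, Q i) w, w⟫_ℂ) atTop
        (𝓝 (((ν w).real (⋃ i, f i) : ℝ) : ℂ)) := fun w => by
      have := hν.isFiniteMeasure w
      have h := (Complex.continuous_ofReal.tendsto _).comp
        (hasSum_measureReal (ν w) hf hd).tendsto_sum_nat
      refine h.congr fun n => ?_
      rw [represents_sum hν hf hd hQ _ w,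
        measureReal_biUnion_finset (fun i _ j _ hij => hd hij) fun i _ => hf i]
      rfl
    have e2 := tendsto_inner_of_tendsto_inner_self e1 (S v) v
    have e3 : ⟪S' (S v), v⟫_ℂ = polarForm (fun w => (((ν w).real (⋃ i, f i) : ℝ) : ℂ)) (S v) v := by
      rw [inner_eq_polarForm]
      congr 1
      exact funext h1'
    rw [← e3] at e2
    rw [mul_apply_eq_comp]
    refine tendsto_nhds_unique e2 ?_
    rw [Set.iUnion_inter]
    have h := (Complex.continuous_ofReal.tendsto _).comp
      (hasSum_measureReal (ν v) (fun i => (hf i).inter hs)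
        (fun i j hij => (hd hij).mono Set.inter_subset_left Set.inter_subset_left)).tendsto_sum_nat
    refine h.congr fun n => ?_
    rw [sum_apply, sum_inner, Function.comp_apply, Complex.ofReal_sum]
    exact Finset.sum_congr rfl fun i _ => (ih i (hQ i) v).symm

theorem Represents.norm_apply_sq (hT : IsSelfAdjoint T) (hν : IsScalarSpectralFamily T ν)
    {s : Set ℝ} (hs : MeasurableSet s) {S : H →L[ℂ] H} (h1 : Represents ν s S)
    (h2 : Commute S T) (v : H) : ‖S v‖ ^ 2 = (ν v).real s := by
  have e := h1.mul hT hν hs hs h1 h2 v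
  have e2 : ⟪S (S v), v⟫_ℂ = ⟪S v, S v⟫_ℂ := h1.isSelfAdjoint.isSymmetric _ _
  rw [mul_apply_eq_comp, e2, Set.inter_self] at e
  rw [← inner_self_eq_norm_sq (𝕜 := ℂ), e, RCLike.re_eq_complex_re, Complex.ofReal_re]

open Classical in
/-- The projection-valued measure of a bounded self-adjoint operator. -/
def spectralPVM (hT : IsSelfAdjoint T) (hν : IsScalarSpectralFamily T ν) :
    ProjectionValuedMeasure H :=
  let Q : Set ℝ → H →L[ℂ] H := fun s =>
    if hs : MeasurableSet s then (exists_represents hT hν s hs).choose else 0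
  have hQ : ∀ s, MeasurableSet s → Represents ν s (Q s) ∧ Commute (Q s) T := fun s hs => by
    simp only [Q, dif_pos hs]
    exact (exists_represents hT hν s hs).choose_spec
  { proj := Q
    isStarProjection := fun s hs => by
      refine ⟨?_, (hQ s hs).1.isSelfAdjoint⟩
      have := (hQ s hs).1.mul hT hν hs hs (hQ s hs).1 (hQ s hs).2
      rw [Set.inter_self] at this
      exact this.unique (hQ s hs).1
    univ := by
      refine (hQ _ MeasurableSet.univ).1.unique fun v => ?_
      rw [hν.measureReal_univ hT]
      simp [inner_self_eq_norm_sq_to_K]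
    inter := fun s t hs ht =>
      (hQ _ (hs.inter ht)).1.unique ((hQ t ht).1.mul hT hν ht hs (hQ s hs).1 (hQ t ht).2)
    iUnion := fun f hf hd x => by
      have hU := MeasurableSet.iUnion hf
      have := hν.isFiniteMeasure x
      have hsum := hasSum_measureReal (ν x) hf hd
      rw [HasSum, tendsto_iff_norm_sub_tendsto_zero]
      -- The remainder represents the part of the union not yet covered, so its squared norm at `x`
      -- is the measure of that part. This upgrades weak to strong convergence.
      have key : ∀ F : Finset ℕ, ‖∑ i ∈ F, Q (f i) x - Q (⋃ i, f i) x‖ =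
          Real.sqrt ((ν x).real (⋃ i, f i) - ∑ i ∈ F, (ν x).real (f i)) := by
        intro F
        have hF : MeasurableSet (⋃ i ∈ F, f i) := F.measurableSet_biUnion fun i _ => hf i
        have hsub : (⋃ i ∈ F, f i) ⊆ ⋃ i, f i := Set.iUnion₂_subset fun i _ =>
          Set.subset_iUnion f i
        have hR := represents_sum hν hf hd (fun i => (hQ _ (hf i)).1) F
        have hD : Represents ν ((⋃ i, f i) \ ⋃ i ∈ F, f i)
            (Q (⋃ i, f i) - ∑ i ∈ F, Q (f i)) := by
          intro v
          have := hν.isFiniteMeasure v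
          rw [measureReal_sdiff hsub hF, sub_apply, inner_sub_left, hR v, (hQ _ hU).1 v]
          push_cast
          rfl
        have hC : Commute (Q (⋃ i, f i) - ∑ i ∈ F, Q (f i)) T :=
          (hQ _ hU).2.sub_left (Commute.sum_left _ _ _ fun i _ => (hQ _ (hf i)).2)
        have e := hD.norm_apply_sq hT hν (hU.diff hF) hC x
        rw [measureReal_sdiff hsub hF,
          measureReal_biUnion_finset (fun i _ j _ hij => hd hij) fun i _ => hf i] at e
        rw [← e, Real.sqrt_sq (norm_nonneg _), sub_apply, norm_sub_rev,
          sum_apply]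
      simp only [key]
      have h3 := (Real.continuous_sqrt.tendsto _).comp
        (hsum.const_sub ((ν x).real (⋃ i, f i)))
      simpa [Function.comp_def] using h3 }

theorem inner_spectralPVM_proj (hT : IsSelfAdjoint T) (hν : IsScalarSpectralFamily T ν)
    {s : Set ℝ} (hs : MeasurableSet s) (v : H) :
    ⟪(spectralPVM hT hν).proj s v, v⟫_ℂ = (((ν v).real s : ℝ) : ℂ) := by
  simp only [spectralPVM, dif_pos hs]
  exact (exists_represents hT hν s hs).choose_spec.1 v

end Bounded

/-! ### Calculus of projection-valued measures and their scalar measures -/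

namespace ProjectionValuedMeasure

variable [CompleteSpace H]

theorem scalarMeasure_apply (P : ProjectionValuedMeasure H) (x : H) {s : Set ℝ}
    (hs : MeasurableSet s) :
    P.scalarMeasure x s = ENNReal.ofReal (RCLike.re ⟪x, P.proj s x⟫_ℂ) :=
  Measure.ofMeasurable_apply s hs

/-- The image of a projection-valued measure under a measurable map. -/
def map (P : ProjectionValuedMeasure H) {g : ℝ → ℝ} (hg : Measurable g) :
    ProjectionValuedMeasure H where
  proj s := P.proj (g ⁻¹' s)
  isStarProjection s hs := P.isStarProjection _ (hg hs)
  univ := P.univ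
  inter s t hs ht := P.inter _ _ (hg hs) (hg ht)
  iUnion f hf hd x := by
    rw [Set.preimage_iUnion]
    exact P.iUnion _ (fun i => hg (hf i)) (fun i j hij => (hd hij).preimage g) x

theorem scalarMeasure_map (P : ProjectionValuedMeasure H) {g : ℝ → ℝ} (hg : Measurable g)
    (x : H) : (P.map hg).scalarMeasure x = (P.scalarMeasure x).map g := by
  ext s hs
  rw [Measure.map_apply hg hs, scalarMeasure_apply _ _ hs, scalarMeasure_apply _ _ (hg hs)]
  rfl

end ProjectionValuedMeasure

theorem scalarMeasure_spectralPVM [CompleteSpace H] {T : H →L[ℂ] H} {ν : H → Measure ℝ}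
    (hT : IsSelfAdjoint T) (hν : IsScalarSpectralFamily T ν) (x : H) :
    (spectralPVM hT hν).scalarMeasure x = ν x := by
  ext s hs
  have := hν.isFiniteMeasure x
  rw [ProjectionValuedMeasure.scalarMeasure_apply _ _ hs, ← inner_conj_symm,
    inner_spectralPVM_proj hT hν hs, Complex.conj_ofReal, RCLike.re_eq_complex_re,
    Complex.ofReal_re, ofReal_measureReal]

namespace ProjectionValuedMeasure

variable [CompleteSpace H] (P : ProjectionValuedMeasure H)

theorem proj_proj {s t : Set ℝ} (hs : MeasurableSet s) (ht : MeasurableSet t) (x : H) :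
    P.proj s (P.proj t x) = P.proj (s ∩ t) x := by
  rw [P.inter s t hs ht]; rfl

theorem proj_univ (x : H) : P.proj Set.univ x = x := by
  rw [P.univ]; rfl

theorem inner_proj_left {s : Set ℝ} (hs : MeasurableSet s) (x y : H) :
    ⟪P.proj s x, y⟫_ℂ = ⟪x, P.proj s y⟫_ℂ :=
  (P.isStarProjection s hs).isSelfAdjoint.isSymmetric x y

theorem inner_proj_self {s : Set ℝ} (hs : MeasurableSet s) (x : H) :
    RCLike.re ⟪x, P.proj s x⟫_ℂ = ‖P.proj s x‖ ^ 2 := by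
  rw [← inner_self_eq_norm_sq (𝕜 := ℂ), P.inner_proj_left hs, P.proj_proj hs hs, Set.inter_self]

theorem scalarMeasure_eq_norm {s : Set ℝ} (hs : MeasurableSet s) (x : H) :
    P.scalarMeasure x s = ENNReal.ofReal (‖P.proj s x‖ ^ 2) := by
  rw [P.scalarMeasure_apply x hs, P.inner_proj_self hs]

theorem scalarMeasure_real {s : Set ℝ} (hs : MeasurableSet s) (x : H) :
    (P.scalarMeasure x).real s = ‖P.proj s x‖ ^ 2 := by
  rw [measureReal_def, P.scalarMeasure_eq_norm hs, ENNReal.toReal_ofReal (sq_nonneg _)]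

instance isFiniteMeasure_scalarMeasure (x : H) : IsFiniteMeasure (P.scalarMeasure x) :=
  ⟨by rw [P.scalarMeasure_eq_norm MeasurableSet.univ]; exact ENNReal.ofReal_lt_top⟩

theorem scalarMeasure_real_univ (x : H) : (P.scalarMeasure x).real Set.univ = ‖x‖ ^ 2 := by
  rw [P.scalarMeasure_real MeasurableSet.univ, P.proj_univ]

theorem proj_eq_zero_iff {s : Set ℝ} (hs : MeasurableSet s) (x : H) :
    P.proj s x = 0 ↔ P.scalarMeasure x s = 0 := by
  rw [P.scalarMeasure_eq_norm hs, ENNReal.ofReal_eq_zero]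
  constructor
  · intro h; simp [h]
  · intro h
    have : ‖P.proj s x‖ ^ 2 = 0 := le_antisymm h (sq_nonneg _)
    simpa using this

theorem scalarMeasure_proj {s : Set ℝ} (hs : MeasurableSet s) (x : H) :
    P.scalarMeasure (P.proj s x) = (P.scalarMeasure x).restrict s := by
  ext t ht
  rw [Measure.restrict_apply ht, P.scalarMeasure_eq_norm ht, P.scalarMeasure_eq_norm (ht.inter hs),
    P.proj_proj ht hs]

/-- The two pieces are orthogonal and their squared norms add up to `‖x‖²`; expanding the square of
the defect gives zero. -/
theorem proj_add_proj_compl {s : Set ℝ} (hs : MeasurableSet s) (x : H) :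
    P.proj s x + P.proj sᶜ x = x := by
  have h0 : ⟪P.proj s x, P.proj sᶜ x⟫_ℂ = 0 := by
    rw [P.inner_proj_left hs, P.proj_proj hs hs.compl, Set.inter_compl_self, P.empty_apply,
      inner_zero_right]
  have h1 := measureReal_compl hs (μ := P.scalarMeasure x)
  rw [P.scalarMeasure_real hs.compl, P.scalarMeasure_real_univ, P.scalarMeasure_real hs] at h1
  have h2 := P.inner_proj_self hs x
  have h3 := P.inner_proj_self hs.compl x
  have h4 : ‖P.proj s x + P.proj sᶜ x‖ ^ 2 = ‖P.proj s x‖ ^ 2 + ‖P.proj sᶜ x‖ ^ 2 := by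
    rw [@norm_add_sq ℂ, h0]; simp
  have h5 : ‖x - (P.proj s x + P.proj sᶜ x)‖ ^ 2 = 0 := by
    rw [@norm_sub_sq ℂ, inner_add_right, map_add, h4, h2, h3, h1]; ring
  have h6 : x - (P.proj s x + P.proj sᶜ x) = 0 := by simpa using h5
  exact (sub_eq_zero.1 h6).symm

end ProjectionValuedMeasure

/-! ### Existence of the spectral measure -/

section Existence

open Filter Topology

variable [CompleteSpace H]

theorem IsScalarSpectralFamily.norm_cfc_apply_sq {T : H →L[ℂ] H} {ν : H → Measure ℝ}
    (hν : IsScalarSpectralFamily T ν) {f : ℝ → ℝ} (hf : Continuous f) (v : H) :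
    ‖cfc f T v‖ ^ 2 = ∫ t, f t ^ 2 ∂ν v := by
  have h := hν.inner_eq (fun t => f t * f t) (hf.mul hf) v
  rw [cfc_mul f f T (by fun_prop) (by fun_prop), mul_apply_eq_comp, inner_cfc_apply_self] at h
  rw [← inner_self_eq_norm_sq (𝕜 := ℂ), h, RCLike.re_eq_complex_re, Complex.ofReal_re]
  simp only [sq]

/-- `T` annihilates the range of the projection at `{0}`, because `∫ t²` over `{0}` vanishes. It
makes the singularity of `t⁻¹` at the origin invisible. -/
theorem IsScalarSpectralFamily.apply_singleton_zero {T : H →L[ℂ] H} {ν : H → Measure ℝ}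
    (hT : IsSelfAdjoint T) (hν : IsScalarSpectralFamily T ν) (hinj : Function.Injective T)
    (x : H) : ν x {0} = 0 := by
  have h0 : MeasurableSet ({0} : Set ℝ) := MeasurableSet.singleton 0
  set P := spectralPVM hT hν
  rw [← scalarMeasure_spectralPVM hT hν, ← P.proj_eq_zero_iff h0]
  apply hinj
  have h1 := hν.norm_cfc_apply_sq continuous_id (P.proj {0} x)
  rw [cfc_id ℝ T, ← scalarMeasure_spectralPVM hT hν, P.scalarMeasure_proj h0] at h1
  have h2 : ∫ t in ({0} : Set ℝ), (id t) ^ 2 ∂(P.scalarMeasure x) = 0 :=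
    setIntegral_eq_zero_of_forall_eq_zero fun t ht => by
      rw [Set.mem_singleton_iff] at ht; simp [ht]
  rw [h2] at h1
  rw [map_zero]
  simpa using h1

/-- The spectral theorem, for a self-adjoint operator with a real point in its resolvent set. -/
theorem exists_isSpectralMeasureOf {K : H →ₗ.[ℂ] H} (hK : IsSelfAdjoint K) {l : ℝ}
    (hl : (l : ℂ) ∈ resolventSet K) :
    ∃ P : ProjectionValuedMeasure H, P.IsSpectralMeasureOf K := by
  set T := resolvent K (l : ℂ) with hTdef
  have hR := isResolventAt_resolvent hl
  have hT : IsSelfAdjoint T := by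
    rw [ContinuousLinearMap.isSelfAdjoint_iff_isSymmetric]
    intro u v
    have := inner_resolvent_left hK hl (by rwa [Complex.conj_ofReal]) u v
    rwa [Complex.conj_ofReal] at this
  obtain ⟨ν, hν⟩ := exists_isScalarSpectralFamily hT
  have hfin := hν.isFiniteMeasure
  have hinj : Function.Injective T := by
    rw [injective_iff_map_eq_zero]
    intro y hy
    have h1 := hR.right_inv y
    have h2 : (⟨_, hR.mem_domain y⟩ : K.domain) = 0 := Subtype.ext hy
    rw [h2, LinearPMap.map_zero] at h1
    rw [← h1]
    simp [← hTdef, hy]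
  -- The inverse of `λ ↦ (λ - l)⁻¹`. Its value at `t = 0` is conventional and has no effect, since
  -- `0` is a null set.
  have hg : Measurable (fun t : ℝ => t⁻¹ + l) := by fun_prop
  have hμ : ∀ x, ((spectralPVM hT hν).map hg).scalarMeasure x =
      (ν x).map (fun t : ℝ => t⁻¹ + l) := fun x => by
    rw [ProjectionValuedMeasure.scalarMeasure_map, scalarMeasure_spectralPVM]
  have hdens : ∀ v, ν (T v) = (ν v).withDensity (fun t => ENNReal.ofReal (t ^ 2)) := fun v => by
    have := hν.cfc_apply_eq_withDensity continuous_id v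
    rwa [cfc_id ℝ T] at this
  have hdm : Measurable (fun t : ℝ => ENNReal.ofReal (t ^ 2)) := by fun_prop
  refine ⟨(spectralPVM hT hν).map hg, fun x => ⟨fun hx => ?_, fun hx => ?_⟩, fun x => ?_⟩
  · obtain ⟨v, rfl⟩ : ∃ v, T v = x := ⟨_, hR.left_inv ⟨x, hx⟩⟩
    rw [hμ, integrable_map_measure (by fun_prop) hg.aemeasurable, hdens,
      integrable_withDensity_iff hdm (by simp)]
    -- The domain is the range of `T`; for `x = T v` the density `t²` cancels the pole and leaves
    -- `(1 + l t)²`, bounded on the spectrum of `T`.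
    refine (hν.integrable (f := fun t => (1 + l * t) ^ 2) (by fun_prop) v).mono
      (by simp only [Function.comp_def]; fun_prop) (Eventually.of_forall fun t => ?_)
    simp only [Function.comp_apply, ENNReal.toReal_ofReal (sq_nonneg t)]
    rcases eq_or_ne t 0 with rfl | ht
    · simp
    · have : (t⁻¹ + l) ^ 2 * t ^ 2 = (1 + l * t) ^ 2 := by field_simp
      rw [this]
  · rw [hμ, integrable_map_measure (by fun_prop) hg.aemeasurable] at hx
    have hinv : Integrable (fun t : ℝ => (t⁻¹) ^ 2) (ν x) := by
      refine ((hx.const_mul 2).add (integrable_const (2 * l ^ 2))).mono (by fun_prop)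
        (Eventually.of_forall fun t => ?_)
      simp only [Function.comp_apply, Pi.add_apply]
      rw [Real.norm_of_nonneg (by positivity), Real.norm_of_nonneg (by positivity)]
      nlinarith [sq_nonneg (t⁻¹ + 2 * l)]
    -- Continuous substitutes for `t⁻¹`, dominated by it. The vectors `w n = h n (T) x` stay bounded
    -- because `t⁻¹` is square integrable, while `T (w n) → x`; as `K T w = w + l T w`, the images
    -- under `K` are bounded too, so `x` lies in the domain.
    let h : ℕ → ℝ → ℝ := fun n t => t / max (t ^ 2) (1 / ((n : ℝ) + 1))
    have hpos : ∀ (n : ℕ) (t : ℝ), 0 < max (t ^ 2) (1 / ((n : ℝ) + 1)) := fun n t =>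
      lt_max_of_lt_right (by positivity)
    have hh : ∀ n, Continuous (h n) := fun n =>
      continuous_id.div (by fun_prop) fun t => (hpos n t).ne'
    have hle : ∀ n t, (h n t) ^ 2 ≤ (t⁻¹) ^ 2 := by
      intro n t
      rcases eq_or_ne t 0 with rfl | ht
      · simp [h]
      · rw [sq_le_sq, abs_div, abs_inv, abs_of_pos (hpos n t), div_le_iff₀ (hpos n t),
          inv_mul_eq_div, le_div_iff₀ (abs_pos.2 ht), ← sq, sq_abs]
        exact le_max_left _ _
    have hth : ∀ n t, 0 ≤ t * h n t ∧ t * h n t ≤ 1 := by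
      intro n t
      have e : t * h n t = t ^ 2 / max (t ^ 2) (1 / ((n : ℝ) + 1)) := by simp only [h]; ring
      rw [e]
      exact ⟨div_nonneg (sq_nonneg t) (hpos n t).le,
        (div_le_one (hpos n t)).2 (le_max_left _ _)⟩
    let w : ℕ → H := fun n => cfc (h n) T x
    have hw : ∀ n, ‖w n‖ ≤ Real.sqrt (∫ t, (t⁻¹) ^ 2 ∂ν x) := by
      intro n
      refine Real.le_sqrt_of_sq_le ?_
      rw [hν.norm_cfc_apply_sq (hh n)]
      exact integral_mono (hν.integrable ((hh n).pow 2) x) hinv (hle n)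
    have hlim : Tendsto (fun n => T (w n)) atTop (𝓝 x) := by
      have hsq : ∀ n, ‖T (w n) - x‖ ^ 2 = ∫ t, (t * h n t - 1) ^ 2 ∂ν x := by
        intro n
        have hc : Continuous (fun t => t * h n t) := continuous_id.mul (hh n)
        rw [← hν.norm_cfc_apply_sq (f := fun t => t * h n t - 1) (hc.sub continuous_const),
          cfc_sub (fun t => t * h n t) (fun _ => 1) T hc.continuousOn (by fun_prop),
          cfc_const_one ℝ T, cfc_mul (fun t => t) (h n) T (by fun_prop) (hh n).continuousOn,
          cfc_id' ℝ T]
        rfl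
      have hd : Tendsto (fun n => ∫ t, (t * h n t - 1) ^ 2 ∂ν x) atTop (𝓝 (∫ _, 0 ∂ν x)) := by
        refine tendsto_integral_of_dominated_convergence (fun _ => 1) (fun n => ?_)
          (integrable_const 1) (fun n => Eventually.of_forall fun t => ?_) ?_
        · exact (((continuous_id.mul (hh n)).sub continuous_const).pow 2).aestronglyMeasurable
        · have := hth n t
          rw [Real.norm_of_nonneg (sq_nonneg _)]
          nlinarith
        · have h0 : ∀ᵐ t ∂ν x, t ≠ 0 := by
            rw [ae_iff]
            simpa using hν.apply_singleton_zero hT hinj x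
          filter_upwards [h0] with t ht
          refine tendsto_const_nhds.congr' ?_
          have := tendsto_one_div_add_atTop_nhds_zero_nat (𝕜 := ℝ)
          filter_upwards [this.eventually (gt_mem_nhds (sq_pos_of_ne_zero ht))] with n hn
          have e : t * h n t = 1 := by
            simp only [h, max_eq_left hn.le]
            field_simp
          rw [e]; simp
      rw [integral_zero] at hd
      simp only [← hsq] at hd
      rw [tendsto_iff_norm_sub_tendsto_zero]
      have := (Real.continuous_sqrt.tendsto _).comp hd
      simpa [Function.comp_def, Real.sqrt_sq (norm_nonneg _)] using this
    refine mem_domain_of_tendsto_of_bounded hK (u := fun n => ⟨T (w n), hR.mem_domain _⟩) hlim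
      (C := Real.sqrt (∫ t, (t⁻¹) ^ 2 ∂ν x) + |l| * (‖T‖ * Real.sqrt (∫ t, (t⁻¹) ^ 2 ∂ν x)))
      fun n => ?_
    have h1 := hR.right_inv (w n)
    rw [sub_eq_iff_eq_add] at h1
    have h2 : ‖T (w n)‖ ≤ ‖T‖ * Real.sqrt (∫ t, (t⁻¹) ^ 2 ∂ν x) :=
      (T.le_opNorm _).trans (mul_le_mul_of_nonneg_left (hw n) (norm_nonneg _))
    rw [h1]
    refine (norm_add_le _ _).trans (add_le_add (hw n) ?_)
    rw [norm_smul, Complex.norm_real, Real.norm_eq_abs]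
    exact mul_le_mul_of_nonneg_left h2 (abs_nonneg _)
  · obtain ⟨x, hx⟩ := x
    obtain ⟨v, rfl⟩ : ∃ v, T v = x := ⟨_, hR.left_inv ⟨x, hx⟩⟩
    have h1 := hR.right_inv v
    rw [sub_eq_iff_eq_add] at h1
    -- With `x = T v` both sides become the integral of `t + l t²` against `ν v`.
    rw [h1, hμ, integral_map hg.aemeasurable (by fun_prop), hdens,
      integral_withDensity_eq_integral_toReal_smul hdm (by simp)]
    have h2 := hν.inner_eq (fun t => t) continuous_id v
    have h3 := hν.inner_eq (fun t => t * t) (by fun_prop) v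
    rw [cfc_mul (fun t => t) (fun t => t) T (by fun_prop) (by fun_prop), cfc_id' ℝ T,
      mul_apply_eq_comp] at h3
    rw [cfc_id' ℝ T] at h2
    have hs : ⟪T (T v), v⟫_ℂ = ⟪T v, T v⟫_ℂ := hT.isSymmetric _ _
    rw [hs] at h3
    rw [← hTdef, inner_add_right, inner_smul_right, h2, h3, ← Complex.ofReal_mul,
      ← Complex.ofReal_add, ← integral_const_mul,
      ← integral_add (hν.integrable (f := fun t => t) continuous_id v)
        (hν.integrable (f := fun t => l * (t * t)) (by fun_prop) v)]
    congr 1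
    refine integral_congr_ae (Eventually.of_forall fun t => ?_)
    simp only [ENNReal.toReal_ofReal (sq_nonneg t), smul_eq_mul]
    rcases eq_or_ne t 0 with rfl | ht
    · simp
    · field_simp

end Existence

/-! ### Consequences of the spectral representation -/

theorem abs_max_zero_le_abs (a : ℝ) : |max a 0| ≤ |a| := by
  rw [abs_of_nonneg (le_max_right a 0)]
  exact max_le (le_abs_self a) (abs_nonneg a)

/-- The signed identity `μ₁ - μ₂ = f γ` becomes an equality of positive measures once the positive
and negative parts of `f` are moved to opposite sides. -/
theorem integral_sub_integral_of_measureReal_sub {α : Type*} [MeasurableSpace α]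
    {μ₁ μ₂ γ : Measure α} [IsFiniteMeasure μ₁] [IsFiniteMeasure μ₂]
    {f g : α → ℝ} (hfm : Measurable f) (hgm : Measurable g) (hf : Integrable f γ) (hg₁ : Integrable g μ₁)
    (hg₂ : Integrable g μ₂) (hgf : Integrable (fun t => f t * g t) γ)
    (h : ∀ r, MeasurableSet r → μ₁.real r - μ₂.real r = ∫ t in r, f t ∂γ) :
    ∫ t, g t ∂μ₁ - ∫ t, g t ∂μ₂ = ∫ t, f t * g t ∂γ := by
  have hm : Measurable fun t => ENNReal.ofReal (f t) := by fun_prop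
  have hm' : Measurable fun t => ENNReal.ofReal (-f t) := by fun_prop
  have f₁ : IsFiniteMeasure (γ.withDensity fun t => ENNReal.ofReal (f t)) :=
    isFiniteMeasure_withDensity_ofReal hf.2
  have f₂ : IsFiniteMeasure (γ.withDensity fun t => ENNReal.ofReal (-f t)) :=
    isFiniteMeasure_withDensity_ofReal hf.neg.2
  have key : μ₁ + γ.withDensity (fun t => ENNReal.ofReal (-f t)) =
      μ₂ + γ.withDensity (fun t => ENNReal.ofReal (f t)) := by
    ext r hr
    have h1 := h r hr
    rw [integral_eq_lintegral_pos_part_sub_lintegral_neg_part hf.restrict,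
      ← withDensity_apply _ hr, ← withDensity_apply _ hr] at h1
    rw [Measure.add_apply, Measure.add_apply,
      ← ENNReal.toReal_eq_toReal_iff' (by finiteness) (by finiteness),
      ENNReal.toReal_add (by finiteness) (by finiteness),
      ENNReal.toReal_add (by finiteness) (by finiteness)]
    simp only [measureReal_def] at h1
    linarith
  have i₁ : Integrable (fun t => (ENNReal.ofReal (f t)).toReal * g t) γ := by
    refine hgf.mono (by fun_prop) (Filter.Eventually.of_forall fun t => ?_)
    rw [norm_mul, norm_mul, ENNReal.toReal_ofReal', Real.norm_eq_abs]
    exact mul_le_mul_of_nonneg_right (abs_max_zero_le_abs _) (norm_nonneg _)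
  have i₂ : Integrable (fun t => (ENNReal.ofReal (-f t)).toReal * g t) γ := by
    refine hgf.mono (by fun_prop) (Filter.Eventually.of_forall fun t => ?_)
    rw [norm_mul, norm_mul, ENNReal.toReal_ofReal', Real.norm_eq_abs, Real.norm_eq_abs (f t),
      ← abs_neg (f t)]
    exact mul_le_mul_of_nonneg_right (abs_max_zero_le_abs _) (norm_nonneg _)
  have j₁ : Integrable g (γ.withDensity fun t => ENNReal.ofReal (f t)) := by
    rw [integrable_withDensity_iff hm (by simp)]
    simpa only [mul_comm] using i₁
  have j₂ : Integrable g (γ.withDensity fun t => ENNReal.ofReal (-f t)) := by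
    rw [integrable_withDensity_iff hm' (by simp)]
    simpa only [mul_comm] using i₂
  have h2 := congrArg (fun μ => ∫ t, g t ∂μ) key
  rw [integral_add_measure hg₁ j₂, integral_add_measure hg₂ j₁,
    integral_withDensity_eq_integral_toReal_smul hm (by simp),
    integral_withDensity_eq_integral_toReal_smul hm' (by simp)] at h2
  simp only [smul_eq_mul] at h2
  have h3 : ∫ t, f t * g t ∂γ = ∫ t, (ENNReal.ofReal (f t)).toReal * g t ∂γ -
      ∫ t, (ENNReal.ofReal (-f t)).toReal * g t ∂γ := by
    rw [← integral_sub i₁ i₂]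
    refine integral_congr_ae (Filter.Eventually.of_forall fun t => ?_)
    simp only [ENNReal.toReal_ofReal']
    rcases le_total (f t) 0 with h0 | h0
    · rw [max_eq_right h0, max_eq_left (neg_nonneg.2 h0)]; ring
    · rw [max_eq_left h0, max_eq_right (neg_nonpos.2 h0)]; ring
  linarith

namespace ProjectionValuedMeasure.IsSpectralMeasureOf

variable [CompleteSpace H] {K : H →ₗ.[ℂ] H} {P : ProjectionValuedMeasure H}

theorem proj_mem_domain (hP : P.IsSpectralMeasureOf K) {s : Set ℝ} (hs : MeasurableSet s) {x : H}
    (hx : x ∈ K.domain) : P.proj s x ∈ K.domain := by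
  rw [hP.mem_domain_iff] at hx ⊢
  rw [P.scalarMeasure_proj hs]
  exact hx.restrict

theorem proj_mem_domain_of_bounded (hP : P.IsSpectralMeasureOf K) {s : Set ℝ}
    (hs : MeasurableSet s) {a b : ℝ} (hab : s ⊆ Set.Icc a b) (x : H) : P.proj s x ∈ K.domain := by
  rw [hP.mem_domain_iff, P.scalarMeasure_proj hs]
  have h : IntegrableOn (fun t : ℝ => t ^ 2) (Set.Icc a b) (P.scalarMeasure x) :=
    (continuous_id.pow 2).continuousOn.integrableOn_Icc
  exact h.mono_set hab

theorem integrable_id (hP : P.IsSpectralMeasureOf K) (x : K.domain) :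
    Integrable (fun t : ℝ => t) (P.scalarMeasure (x : H)) := by
  refine (((hP.mem_domain_iff x).1 x.2).add (integrable_const (1 : ℝ))).mono (by fun_prop)
    (Filter.Eventually.of_forall fun t => ?_)
  simp only [Pi.add_apply]
  rw [Real.norm_of_nonneg (by positivity : (0 : ℝ) ≤ t ^ 2 + 1), Real.norm_eq_abs]
  rw [← sq_abs]
  nlinarith [sq_nonneg (|t| - 1)]

/-- All spectral pieces of `x` and `y` are orthogonal, so for `|c| = 1` the measure of `x + c y` is
`μ_x + μ_y`. The form identity then kills the cross terms, and `c = 1` with `c = i` separates them.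
-/
theorem inner_apply_eq_zero (hP : P.IsSpectralMeasureOf K) {s : Set ℝ} (hs : MeasurableSet s)
    (x y : K.domain) (hx : P.proj s x = x) (hy : P.proj s (y : H) = 0) :
    ⟪(x : H), K y⟫_ℂ = 0 := by
  have horth : ∀ t, MeasurableSet t → ⟪P.proj t (x : H), P.proj t (y : H)⟫_ℂ = 0 := by
    intro t ht
    rw [P.inner_proj_left ht, P.proj_proj ht ht, ← P.inner_proj_left (ht.inter ht), ← hx,
      P.proj_proj (ht.inter ht) hs, Set.inter_comm, ← P.proj_proj hs (ht.inter ht),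
      P.inner_proj_left hs, hy, inner_zero_right]
  have key : ∀ c : ℂ, ‖c‖ = 1 → c * ⟪(x : H), K y⟫_ℂ + starRingEnd ℂ c * ⟪(y : H), K x⟫_ℂ = 0 := by
    intro c hc
    have hm : P.scalarMeasure ((x + c • y : K.domain) : H) =
        P.scalarMeasure (x : H) + P.scalarMeasure (y : H) := by
      ext t ht
      rw [Measure.add_apply, P.scalarMeasure_eq_norm ht, P.scalarMeasure_eq_norm ht,
        P.scalarMeasure_eq_norm ht, ← ENNReal.ofReal_add (sq_nonneg _) (sq_nonneg _)]
      congr 1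
      rw [Submodule.coe_add, Submodule.coe_smul, map_add, map_smul, @norm_add_sq ℂ,
        inner_smul_right, horth t ht, norm_smul, hc]
      simp
    have h := hP.inner_eq (x + c • y)
    rw [hm, integral_add_measure (hP.integrable_id x) (hP.integrable_id y), Complex.ofReal_add,
      ← hP.inner_eq, ← hP.inner_eq, LinearPMap.map_add, LinearPMap.map_smul, Submodule.coe_add,
      Submodule.coe_smul, inner_add_left, inner_add_right, inner_add_right, inner_smul_left,
      inner_smul_left, inner_smul_right, inner_smul_right] at h
    have hcc : starRingEnd ℂ c * c = 1 := by
      rw [Complex.conj_mul', hc]; simp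
    linear_combination h - ⟪(y : H), K y⟫_ℂ * hcc
  have h1 := key 1 (by simp)
  have h2 := key Complex.I (by simp)
  rw [Complex.conj_I] at h2
  rw [map_one] at h1
  have h3 : Complex.I * (2 * ⟪(x : H), K y⟫_ℂ) = 0 := by linear_combination h2 + Complex.I * h1
  simpa using h3

/-- By the vanishing cross terms `K` maps domain vectors of each range `P(t)H` into that range;
apply this to `s` and to its complement. -/
theorem apply_proj (hP : P.IsSpectralMeasureOf K) (hK : IsSelfAdjoint K) {s : Set ℝ}
    (hs : MeasurableSet s) (x : K.domain) :
    K ⟨P.proj s x, hP.proj_mem_domain hs x.2⟩ = P.proj s (K x) := by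
  have key : ∀ t, ∀ ht : MeasurableSet t,
      P.proj tᶜ (K ⟨P.proj t x, hP.proj_mem_domain ht x.2⟩) = 0 := by
    intro t ht
    refine hK.dense_domain.eq_zero_of_inner_right ℂ fun y hy => ?_
    rw [← P.inner_proj_left ht.compl]
    refine hP.inner_apply_eq_zero ht.compl ⟨_, hP.proj_mem_domain ht.compl hy⟩ _ ?_ ?_
    · rw [P.proj_proj ht.compl ht.compl, Set.inter_self]
    · rw [P.proj_proj ht.compl ht, Set.compl_inter_self, P.empty_apply]
  have hx : x = ⟨P.proj s x, hP.proj_mem_domain hs x.2⟩ +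
      ⟨P.proj sᶜ x, hP.proj_mem_domain hs.compl x.2⟩ :=
    Subtype.ext (P.proj_add_proj_compl hs (x : H)).symm
  have h1 := key sᶜ hs.compl
  simp only [compl_compl] at h1
  conv_rhs => rw [hx]
  rw [LinearPMap.map_add, map_add, h1, add_zero]
  have h2 := P.proj_add_proj_compl hs (K ⟨P.proj s x, hP.proj_mem_domain hs x.2⟩)
  rw [key s hs, add_zero] at h2
  exact h2.symm

/-- The definition of a spectral measure only gives the form of `K`. On a bounded spectral set `y =
K x` is again in the domain, so `‖K x‖² = ⟪x, K y⟫` can be recovered by polarizing between `x + y`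
and `x - y`. -/
theorem norm_apply_sq_of_bounded (hP : P.IsSpectralMeasureOf K) (hK : IsSelfAdjoint K)
    {s : Set ℝ} (hs : MeasurableSet s) {a b : ℝ} (hab : s ⊆ Set.Icc a b) (x : K.domain)
    (hx : P.proj s x = x) : ‖K x‖ ^ 2 = ∫ t, t ^ 2 ∂(P.scalarMeasure (x : H)) := by
  have hy : P.proj s (K x) = K x := by
    have h := hP.apply_proj hK hs x
    rw [← h]
    exact congrArg K (Subtype.ext hx)
  have hyd : K x ∈ K.domain := by
    rw [← hy]; exact hP.proj_mem_domain_of_bounded hs hab _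
  set y : K.domain := ⟨K x, hyd⟩ with hydef
  have hyx : (y : H) = K x := rfl
  have i2 := (hP.mem_domain_iff x).1 x.2
  -- The measures of `x ± y` differ by `4 t μ_x`, since `⟪P(r)x, P(r)Kx⟫ = ⟪P(r)x, K P(r)x⟫` is the
  -- integral of `t` over `r`.
  have h := integral_sub_integral_of_measureReal_sub
    (μ₁ := P.scalarMeasure ((x + y : K.domain) : H))
    (μ₂ := P.scalarMeasure ((x - y : K.domain) : H)) (γ := P.scalarMeasure (x : H))
    (f := fun t => 4 * t) (g := fun t => t) (by fun_prop) (by fun_prop)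
    ((hP.integrable_id x).const_mul 4) (hP.integrable_id _) (hP.integrable_id _)
    ((i2.const_mul 4).congr (Filter.Eventually.of_forall fun t => by simp only; ring)) (by
      intro r hr
      have e1 : RCLike.re ⟪P.proj r (x : H), P.proj r (y : H)⟫_ℂ =
          ∫ t in r, t ∂(P.scalarMeasure (x : H)) := by
        have h := hP.inner_eq ⟨P.proj r x, hP.proj_mem_domain hr x.2⟩
        rw [hP.apply_proj hK hr, P.scalarMeasure_proj hr] at h
        rw [hyx, h, RCLike.re_eq_complex_re, Complex.ofReal_re]
      rw [P.scalarMeasure_real hr, P.scalarMeasure_real hr, Submodule.coe_add, Submodule.coe_sub,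
        map_add, map_sub, @norm_add_sq ℂ, @norm_sub_sq ℂ, integral_const_mul, ← e1]
      ring)
  have hpol : (⟪((x + y : K.domain) : H), K (x + y)⟫_ℂ).re
      - (⟪((x - y : K.domain) : H), K (x - y)⟫_ℂ).re = 4 * ‖K x‖ ^ 2 := by
    have e1 : ⟪(x : H), K y⟫_ℂ = ⟪K x, K x⟫_ℂ := by rw [← inner_apply_left hK]
    have e2 : ⟪(y : H), K x⟫_ℂ = ⟪K x, K x⟫_ℂ := rfl
    have e3 := inner_self_eq_norm_sq (𝕜 := ℂ) (K x)
    rw [RCLike.re_eq_complex_re] at e3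
    rw [LinearPMap.map_add, LinearPMap.map_sub, Submodule.coe_add, Submodule.coe_sub,
      inner_add_left, inner_add_right, inner_add_right, inner_sub_left, inner_sub_right,
      inner_sub_right, e1, e2, ← e3]
    simp only [Complex.add_re, Complex.sub_re]
    ring
  rw [hP.inner_eq, hP.inner_eq, Complex.ofReal_re, Complex.ofReal_re, h] at hpol
  have e : ∫ t, 4 * t * t ∂(P.scalarMeasure (x : H)) =
      4 * ∫ t, t ^ 2 ∂(P.scalarMeasure (x : H)) := by
    rw [← integral_const_mul]
    exact integral_congr_ae (Filter.Eventually.of_forall fun t => by simp only; ring)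
  linarith

/-- It suffices to compare bounded sets, where `K` commutes with the projection and `‖(K - z) P(s)
x‖²` expands into moments of `μ_x`. The spectral estimates below are read off from this density. -/
theorem scalarMeasure_apply_sub (hP : P.IsSpectralMeasureOf K) (hK : IsSelfAdjoint K) (z : ℂ)
    (x : K.domain) : P.scalarMeasure (K x - z • (x : H)) =
      (P.scalarMeasure (x : H)).withDensity (fun t => ENNReal.ofReal (‖(t : ℂ) - z‖ ^ 2)) := by
  have hU : ⋃ n : ℕ, Set.Icc (-(n : ℝ)) n = Set.univ := by
    refine Set.eq_univ_of_forall fun t => ?_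
    obtain ⟨n, hn⟩ := exists_nat_ge |t|
    exact Set.mem_iUnion.2 ⟨n, abs_le.1 hn⟩
  rw [Measure.ext_iff_of_iUnion_eq_univ hU]
  intro n
  ext r hr
  rw [Measure.restrict_apply hr, Measure.restrict_apply hr]
  set s := r ∩ Set.Icc (-(n : ℝ)) n
  have hs : MeasurableSet s := hr.inter measurableSet_Icc
  have hsub : s ⊆ Set.Icc (-(n : ℝ)) n := Set.inter_subset_right
  set u : K.domain := ⟨P.proj s x, hP.proj_mem_domain hs x.2⟩ with hu
  have hux : (u : H) = P.proj s x := rfl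
  have e1 : P.proj s (K x - z • (x : H)) = K u - z • (u : H) := by
    rw [map_sub, map_smul, hP.apply_proj hK hs]
  have e2 := hP.norm_apply_sq_of_bounded hK hs hsub u (by
    rw [hux, P.proj_proj hs hs, Set.inter_self])
  have e3 : P.scalarMeasure (u : H) = (P.scalarMeasure (x : H)).restrict s :=
    P.scalarMeasure_proj hs _
  have i1 := hP.integrable_id u
  have i2 := (hP.mem_domain_iff u).1 u.2
  have hn : ∀ t : ℝ, ‖(t : ℂ) - z‖ ^ 2 = t ^ 2 - (2 * z.re) * t + ‖z‖ ^ 2 := by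
    intro t
    rw [← Complex.normSq_eq_norm_sq, ← Complex.normSq_eq_norm_sq, Complex.normSq_apply,
      Complex.normSq_apply]
    simp only [Complex.sub_re, Complex.sub_im, Complex.ofReal_re, Complex.ofReal_im]
    ring
  have i3 : Integrable (fun t : ℝ => ‖(t : ℂ) - z‖ ^ 2) (P.scalarMeasure (u : H)) := by
    simp only [hn]
    exact (i2.sub (i1.const_mul _)).add (integrable_const _)
  have e4 : ‖K u - z • (u : H)‖ ^ 2 = ∫ t, ‖(t : ℂ) - z‖ ^ 2 ∂(P.scalarMeasure (u : H)) := by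
    have e5 : RCLike.re ⟪K u, z • (u : H)⟫_ℂ = z.re * ∫ t, t ∂(P.scalarMeasure (u : H)) := by
      rw [inner_smul_right, inner_apply_left hK, hP.inner_eq, RCLike.re_eq_complex_re,
        Complex.re_mul_ofReal]
    simp only [hn]
    have i4 : Integrable (fun t : ℝ => t ^ 2 - 2 * z.re * t) (P.scalarMeasure (u : H)) :=
      i2.sub (i1.const_mul _)
    rw [integral_add i4 (integrable_const _),
      integral_sub i2 (i1.const_mul _), integral_const_mul, integral_const,
      P.scalarMeasure_real_univ, ← e2, @norm_sub_sq ℂ, e5, norm_smul, smul_eq_mul]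
    ring
  rw [P.scalarMeasure_eq_norm hs, e1, e4, withDensity_apply _ hs, e3,
    ofReal_integral_eq_lintegral_ofReal (e3 ▸ i3) (Filter.Eventually.of_forall fun t =>
      sq_nonneg _)]

end ProjectionValuedMeasure.IsSpectralMeasureOf

/-! ### Norm continuity of the resolvent and the region left of the spectrum -/

section Continuity

open Filter Topology

variable [CompleteSpace H]

/-- The resolvent identity reads `R(z) (1 - (z - w) R(w)) = R(w)`. Near `w` the second factor is
invertible, and inversion is continuous at the identity. -/
theorem continuousOn_resolvent (K : H →ₗ.[ℂ] H) : ContinuousOn (resolvent K) (resolventSet K) := by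
  intro w hw
  let U : ℂ → H →L[ℂ] H := fun z => 1 - (z - w) • resolvent K w
  have hU : Continuous U := by fun_prop
  have hUw : U w = 1 := by simp [U]
  have hunit : ∀ᶠ z in 𝓝 w, IsUnit (U z) := by
    have : {T : H →L[ℂ] H | IsUnit T} ∈ 𝓝 (U w) := by
      rw [hUw]; exact Units.isOpen.mem_nhds isUnit_one
    exact hU.continuousAt this
  have hc : ContinuousAt (fun z => resolvent K w * Ring.inverse (U z)) w := by
    have h1 : ContinuousAt Ring.inverse (U w) := by
      rw [hUw]
      exact NormedRing.inverse_continuousAt (1 : (H →L[ℂ] H)ˣ)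
    exact continuousAt_const.mul (h1.comp hU.continuousAt)
  have heq : ∀ z ∈ resolventSet K, IsUnit (U z) →
      resolvent K z = resolvent K w * Ring.inverse (U z) := by
    intro z hz hu
    have h := resolvent_sub_resolvent hz hw
    have h2 : resolvent K z * U z = resolvent K w := by
      simp only [U]
      rw [mul_sub, mul_one, mul_smul_comm, sub_eq_iff_eq_add, ← sub_eq_iff_eq_add']
      exact h
    rw [← h2, mul_assoc, Ring.mul_inverse_cancel _ hu, mul_one]
  refine (hc.continuousWithinAt (s := resolventSet K)).congr_of_eventuallyEq ?_
    (heq w hw (by rw [hUw]; exact isUnit_one))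
  filter_upwards [self_mem_nhdsWithin, hunit.filter_mono nhdsWithin_le_nhds] with z hz hu
  exact heq z hz hu

theorem mem_resolventSet_of_re_lt_sInf {K : H →ₗ.[ℂ] H} (hK : IsSelfAdjoint K)
    (hb : IsBoundedBelow K) {z : ℂ} (hz : z.re < sInf (realSpectrum K)) : z ∈ resolventSet K := by
  by_cases h : z.im = 0
  · have e : ((z.re : ℝ) : ℂ) = z := Complex.ext (by simp) (by simp [h])
    rw [← e]
    exact ofReal_mem_resolventSet_of_lt_sInf hK hb hz
  · exact mem_resolventSet_of_im_ne_zero hK h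

end Continuity

/-! ### Resolvent and eigenvectors in the spectral representation -/

namespace ProjectionValuedMeasure.IsSpectralMeasureOf

variable [CompleteSpace H] {K : H →ₗ.[ℂ] H} {P : ProjectionValuedMeasure H} {z : ℂ}

theorem scalarMeasure_eq_withDensity (hP : P.IsSpectralMeasureOf K) (hK : IsSelfAdjoint K)
    (hz : z ∈ resolventSet K) (v : H) :
    P.scalarMeasure v = (P.scalarMeasure (resolvent K z v)).withDensity
      (fun t => ENNReal.ofReal (‖(t : ℂ) - z‖ ^ 2)) := by
  have h := hP.scalarMeasure_apply_sub hK z ⟨_, resolvent_mem_domain hz v⟩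
  rwa [(isResolventAt_resolvent hz).right_inv] at h

/-- For `x = R(z)v` one has `μ_v = |t - z|² μ_x`, which turns the integrand into `t - z̄`, also at
`t = z`, where both are zero. Its integral is `⟪(K - z)x, x⟫`. -/
theorem inner_resolvent_self (hP : P.IsSpectralMeasureOf K) (hK : IsSelfAdjoint K)
    (hz : z ∈ resolventSet K) (v : H) :
    ⟪v, resolvent K z v⟫_ℂ = ∫ t : ℝ, ((t : ℂ) - z)⁻¹ ∂(P.scalarMeasure v) := by
  have hm : Measurable fun t : ℝ => ENNReal.ofReal (‖(t : ℂ) - z‖ ^ 2) := by fun_prop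
  rw [hP.scalarMeasure_eq_withDensity hK hz,
    integral_withDensity_eq_integral_toReal_smul hm (by simp)]
  set x : K.domain := ⟨_, resolvent_mem_domain hz v⟩
  have hx : resolvent K z v = (x : H) := rfl
  have hv : v = K x - z • (x : H) := ((isResolventAt_resolvent hz).right_inv v).symm
  have i1 := hP.integrable_id x
  have e : ∀ t : ℝ, (ENNReal.ofReal (‖(t : ℂ) - z‖ ^ 2)).toReal • ((t : ℂ) - z)⁻¹ =
      (t : ℂ) - starRingEnd ℂ z := by
    intro t
    rw [ENNReal.toReal_ofReal (sq_nonneg _), Complex.real_smul, Complex.ofReal_pow,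
      ← Complex.mul_conj', map_sub, Complex.conj_ofReal]
    by_cases h0 : (t : ℂ) - z = 0
    · have h1 : (t : ℂ) - starRingEnd ℂ z = 0 := by
        rw [← Complex.conj_ofReal t, ← map_sub, h0, map_zero]
      rw [h1]; simp
    · field_simp
  simp only [e]
  rw [integral_sub i1.ofReal (integrable_const _), integral_const, hx,
    P.scalarMeasure_real_univ, integral_complex_ofReal, ← hP.inner_eq]
  nth_rw 1 [hv]
  rw [inner_sub_left, inner_smul_left, inner_apply_left hK, inner_self_eq_norm_sq_to_K,
    Complex.real_smul, Complex.ofReal_pow, mul_comm]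
  rfl

theorem resolvent_proj (hP : P.IsSpectralMeasureOf K) (hK : IsSelfAdjoint K)
    (hz : z ∈ resolventSet K) {s : Set ℝ} (hs : MeasurableSet s) (v : H) :
    resolvent K z (P.proj s v) = P.proj s (resolvent K z v) := by
  set x : K.domain := ⟨_, resolvent_mem_domain hz v⟩
  have hx : resolvent K z v = (x : H) := rfl
  have hv : v = K x - z • (x : H) := ((isResolventAt_resolvent hz).right_inv v).symm
  have h := (isResolventAt_resolvent hz).left_inv ⟨_, hP.proj_mem_domain hs x.2⟩
  rw [hP.apply_proj hK hs, ← map_smul, ← map_sub, ← hv] at h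
  rw [h, hx]

/-- `x = R(z)v` also lies in the range of `P(s)`, and `‖v‖²` is the integral over `s` of `|t - z|² ≥
d²` against `μ_x`. -/
theorem mul_norm_resolvent_le (hP : P.IsSpectralMeasureOf K) (hK : IsSelfAdjoint K)
    (hz : z ∈ resolventSet K) {s : Set ℝ} (hs : MeasurableSet s) {d : ℝ} (hd : 0 ≤ d)
    (hds : ∀ t ∈ s, d ≤ ‖(t : ℂ) - z‖) {v : H} (hv : P.proj s v = v) :
    d * ‖resolvent K z v‖ ≤ ‖v‖ := by
  set x := resolvent K z v with hx
  have hPx : P.proj s x = x := by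
    rw [hx, ← hP.resolvent_proj hK hz hs, hv]
  have h1 := congrArg (fun μ => μ s) (hP.scalarMeasure_eq_withDensity hK hz v)
  rw [P.scalarMeasure_eq_norm hs, hv, withDensity_apply _ hs, ← hx] at h1
  have h2 : ENNReal.ofReal (d ^ 2) * P.scalarMeasure x s ≤
      ∫⁻ t in s, ENNReal.ofReal (‖(t : ℂ) - z‖ ^ 2) ∂(P.scalarMeasure x) := by
    rw [← setLIntegral_const]
    refine setLIntegral_mono (by fun_prop) fun t ht => ENNReal.ofReal_le_ofReal ?_
    exact pow_le_pow_left₀ hd (hds t ht) 2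
  rw [← h1, P.scalarMeasure_eq_norm hs, hPx, ← ENNReal.ofReal_mul (sq_nonneg d),
    ENNReal.ofReal_le_ofReal_iff (sq_nonneg _), ← mul_pow] at h2
  exact le_of_sq_le_sq h2 (norm_nonneg _)

/-- `|t - l|² μ_x` is the measure of `(K - l)x = 0`, so `μ_x` lives on `{l}`. -/
theorem proj_eq_zero_of_eigenvector (hP : P.IsSpectralMeasureOf K) (hK : IsSelfAdjoint K)
    {l : ℝ} {x : K.domain} (hx : K x = (l : ℂ) • (x : H)) {s : Set ℝ} (hs : MeasurableSet s)
    (hl : l ∉ s) : P.proj s (x : H) = 0 := by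
  have h := congrArg (fun μ => μ s) (hP.scalarMeasure_apply_sub hK l x)
  rw [hx, sub_self, P.scalarMeasure_eq_norm hs, map_zero, norm_zero,
    zero_pow two_ne_zero, ENNReal.ofReal_zero, eq_comm,
    withDensity_apply_eq_zero' (by fun_prop)] at h
  rw [P.proj_eq_zero_iff hs]
  refine measure_mono_null ?_ h
  intro t ht
  refine ⟨?_, ht⟩
  have h0 : (t : ℂ) - l ≠ 0 := by
    rw [sub_ne_zero, Ne, Complex.ofReal_inj]
    rintro rfl
    exact hl ht
  have h1 : 0 < ‖(t : ℂ) - l‖ ^ 2 := by positivity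
  exact (ENNReal.ofReal_pos.2 h1).ne'

theorem proj_eq_zero_of_mem_purePointSubspace (hP : P.IsSpectralMeasureOf K)
    (hK : IsSelfAdjoint K) {s : Set ℝ} (hs : MeasurableSet s)
    (hd : Disjoint s (pointSpectrum K)) {v : H} (hv : v ∈ purePointSubspace K) :
    P.proj s v = 0 := by
  have h : purePointSubspace K ≤ LinearMap.ker (P.proj s : H →ₗ[ℂ] H) := by
    refine Submodule.topologicalClosure_minimal _ (Submodule.span_le.2 ?_)
      (ContinuousLinearMap.isClosed_ker (P.proj s))
    rintro _ ⟨l, x, rfl, hx⟩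
    by_cases h0 : (x : H) = 0
    · rw [h0]; exact Submodule.zero_mem _
    · exact hP.proj_eq_zero_of_eigenvector hK hx hs fun hl =>
        Set.disjoint_left.1 hd hl ⟨x, h0, hx⟩
  exact h hv

/-- `(K - l)` annihilates `P({l})v`, because the density `|t - l|²` vanishes on `{l}`; a nonzero
such vector would be an eigenvector. -/
theorem proj_singleton_eq_zero (hP : P.IsSpectralMeasureOf K) (hK : IsSelfAdjoint K) {l : ℝ}
    (hl : l ∉ pointSpectrum K) (v : H) : P.proj {l} v = 0 := by
  have hs : MeasurableSet ({l} : Set ℝ) := MeasurableSet.singleton l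
  set x : K.domain := ⟨P.proj {l} v, hP.proj_mem_domain_of_bounded hs (a := l) (b := l)
    (by simp) v⟩
  by_contra h0
  refine hl ⟨x, h0, ?_⟩
  have h := congrArg (fun μ => μ Set.univ) (hP.scalarMeasure_apply_sub hK l x)
  have hx : (x : H) = P.proj {l} v := rfl
  rw [P.scalarMeasure_eq_norm MeasurableSet.univ, P.proj_univ, withDensity_apply _ .univ,
    Measure.restrict_univ, hx, P.scalarMeasure_proj hs, lintegral_singleton] at h
  rw [sub_self, norm_zero, zero_pow two_ne_zero, ENNReal.ofReal_zero, zero_mul,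
    ENNReal.ofReal_eq_zero] at h
  have h2 : ‖K x - (l : ℂ) • (x : H)‖ ^ 2 = 0 := le_antisymm h (sq_nonneg _)
  exact sub_eq_zero.1 (by simpa using h2)

/-- Near a resolvent point `l`, a vector `x` in the range of `P(l - ε, l + ε)` satisfies `‖(K - l)x‖
≤ ε‖x‖`, which contradicts boundedness of the resolvent unless `x = 0`. -/
theorem scalarMeasure_Iio_eq_zero (hP : P.IsSpectralMeasureOf K) (hK : IsSelfAdjoint K)
    (hb : IsBoundedBelow K) (v : H) :
    P.scalarMeasure v (Set.Iio (sInf (realSpectrum K))) = 0 := by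
  refine measure_null_of_locally_null _ fun l hl => ?_
  have hz := ofReal_mem_resolventSet_of_lt_sInf hK hb hl
  -- Chosen so that `‖R(l)‖ ε ≤ 1/2`; the summand `1` keeps the denominator positive.
  set ε : ℝ := 1 / (2 * (‖resolvent K l‖ + 1)) with hε
  have hε0 : 0 < ε := by positivity
  have hs : MeasurableSet (Set.Ioo (l - ε) (l + ε)) := measurableSet_Ioo
  refine ⟨Set.Ioo (l - ε) (l + ε), mem_nhdsWithin_of_mem_nhds
    (Ioo_mem_nhds (by linarith) (by linarith)), ?_⟩
  rw [← P.proj_eq_zero_iff hs]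
  set x : K.domain := ⟨P.proj (Set.Ioo (l - ε) (l + ε)) v,
    hP.proj_mem_domain_of_bounded hs Set.Ioo_subset_Icc_self v⟩ with hxdef
  have hx : (x : H) = P.proj (Set.Ioo (l - ε) (l + ε)) v := rfl
  have h1 : ‖K x - (l : ℂ) • (x : H)‖ ≤ ε * ‖(x : H)‖ := by
    have h := congrArg (fun μ => μ Set.univ) (hP.scalarMeasure_apply_sub hK l x)
    rw [P.scalarMeasure_eq_norm MeasurableSet.univ, P.proj_univ, withDensity_apply _ .univ,
      Measure.restrict_univ] at h
    have h2 : ∫⁻ t, ENNReal.ofReal (‖(t : ℂ) - (l : ℂ)‖ ^ 2) ∂(P.scalarMeasure (x : H)) ≤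
        ENNReal.ofReal (ε ^ 2) * P.scalarMeasure (x : H) Set.univ := by
      rw [hx, P.scalarMeasure_proj hs, Measure.restrict_apply_univ, ← setLIntegral_const]
      refine setLIntegral_mono (by fun_prop) fun t ht => ENNReal.ofReal_le_ofReal ?_
      rw [← Complex.ofReal_sub, Complex.norm_real, Real.norm_eq_abs]
      refine pow_le_pow_left₀ (abs_nonneg _) (abs_le.2 ⟨?_, ?_⟩) 2
      · linarith [ht.1]
      · linarith [ht.2]
    rw [← h, P.scalarMeasure_eq_norm .univ, P.proj_univ, ← ENNReal.ofReal_mul (sq_nonneg ε),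
      ENNReal.ofReal_le_ofReal_iff (by positivity), ← mul_pow] at h2
    exact le_of_sq_le_sq h2 (by positivity)
  have h2 : ‖(x : H)‖ ≤ ‖resolvent K l‖ * ‖K x - (l : ℂ) • (x : H)‖ := by
    have := (isResolventAt_resolvent hz).left_inv x
    nth_rw 1 [← this]
    exact ContinuousLinearMap.le_opNorm _ _
  have h3 : ‖(x : H)‖ ≤ 1 / 2 * ‖(x : H)‖ := by
    refine h2.trans ((mul_le_mul_of_nonneg_left h1 (norm_nonneg _)).trans ?_)
    rw [← mul_assoc]
    refine mul_le_mul_of_nonneg_right ?_ (norm_nonneg _)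
    rw [hε, mul_one_div, div_le_iff₀ (by positivity)]
    linarith
  have h4 : ‖(x : H)‖ = 0 := le_antisymm (by linarith) (norm_nonneg _)
  rwa [norm_eq_zero] at h4

end ProjectionValuedMeasure.IsSpectralMeasureOf

/-! ### Weighted resolvents near the energy `E` -/

section Weighted

theorem ker_toPMap_top {B : H →L[ℂ] H} (hB : Function.Injective B) :
    ((B : H →ₗ[ℂ] H).toPMap ⊤).toFun.ker = ⊥ := by
  rw [LinearMap.ker_eq_bot]
  intro x y h
  exact Subtype.ext (hB h)

theorem mem_inverseOp_domain {B : H →L[ℂ] H} {y : H} :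
    y ∈ (inverseOp B).domain ↔ ∃ w, B w = y := by
  rw [inverseOp, LinearPMap.inverse_domain, LinearMap.mem_range]
  constructor
  · rintro ⟨x, hx⟩; exact ⟨x, hx⟩
  · rintro ⟨w, hw⟩; exact ⟨⟨w, trivial⟩, hw⟩

theorem inverseOp_apply {B : H →L[ℂ] H} (hB : Function.Injective B) {w : H}
    {y : (inverseOp B).domain} (h : B w = y) : inverseOp B y = w :=
  LinearPMap.inverse_apply_eq (ker_toPMap_top hB) (x := ⟨w, trivial⟩) h

theorem IsBoundedMulInverse.exists_bound {A B : H →L[ℂ] H} (hB : Function.Injective B)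
    (h : IsBoundedMulInverse A B) : ∃ C, 0 ≤ C ∧ ∀ x, ‖A x‖ ≤ C * ‖B x‖ := by
  obtain ⟨C, hC⟩ := h
  refine ⟨max C 0, le_max_right _ _, fun x => ?_⟩
  have h1 := hC ⟨B x, mem_inverseOp_domain.2 ⟨x, rfl⟩⟩
  rw [inverseOp_apply hB (w := x) rfl] at h1
  exact h1.trans (mul_le_mul_of_nonneg_right (le_max_left _ _) (norm_nonneg _))

theorem IsBoundedInverseMul.exists_bound {A B : H →L[ℂ] H} (hB : Function.Injective B)
    (h : IsBoundedInverseMul B A) :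
    ∃ C, 0 ≤ C ∧ Dense {x : H | ∃ w, A x = B w ∧ ‖w‖ ≤ C * ‖x‖} := by
  obtain ⟨hd, C, hC⟩ := h
  refine ⟨max C 0, le_max_right _ _, hd.mono fun x hx => ?_⟩
  obtain ⟨w, hw⟩ := mem_inverseOp_domain.1 hx
  have h1 := hC x hx
  rw [inverseOp_apply hB (w := w) hw] at h1
  exact ⟨w, hw.symm, h1.trans (mul_le_mul_of_nonneg_right (le_max_left _ _) (norm_nonneg _))⟩

/-- A bound for `B T B` gives a bound for `A₁ T A₂`. -/
theorem exists_norm_comp_comp_le {A₁ A₂ B : H →L[ℂ] H} (hB : Function.Injective B)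
    (hA₁ : IsBoundedMulInverse A₁ B) (hA₂ : IsBoundedInverseMul B A₂) :
    ∃ C, 0 ≤ C ∧ ∀ T : H →L[ℂ] H, ‖A₁ ∘L T ∘L A₂‖ ≤ C * ‖B ∘L T ∘L B‖ := by
  obtain ⟨C₁, h₁, hC₁⟩ := hA₁.exists_bound hB
  obtain ⟨C₂, h₂, hC₂⟩ := hA₂.exists_bound hB
  refine ⟨C₁ * C₂, mul_nonneg h₁ h₂, fun T => ContinuousLinearMap.opNorm_le_bound _
    (mul_nonneg (mul_nonneg h₁ h₂) (norm_nonneg _)) fun x => ?_⟩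
  -- The factorization `A₂ x = B w` is available only for a dense set of `x`; the final inequality
  -- is closed, hence extends.
  have hcl : IsClosed {x : H | ‖(A₁ ∘L T ∘L A₂) x‖ ≤ C₁ * C₂ * ‖B ∘L T ∘L B‖ * ‖x‖} :=
    isClosed_le (by fun_prop) (by fun_prop)
  refine hcl.closure_subset_iff.2 ?_ (hC₂ x)
  rintro x ⟨w, hw, hwx⟩
  change ‖A₁ (T (A₂ x))‖ ≤ _
  rw [hw]
  calc ‖A₁ (T (B w))‖ ≤ C₁ * ‖(B ∘L T ∘L B) w‖ := hC₁ _
    _ ≤ C₁ * (‖B ∘L T ∘L B‖ * (C₂ * ‖x‖)) := by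
        refine mul_le_mul_of_nonneg_left ?_ h₁
        exact (ContinuousLinearMap.le_opNorm _ _).trans
          (mul_le_mul_of_nonneg_left hwx (norm_nonneg _))
    _ = C₁ * C₂ * ‖B ∘L T ∘L B‖ * ‖x‖ := by ring

variable [CompleteSpace H]

theorem exists_ball_disjoint_of_infEDist_pos {E : ℝ} {S : Set ℝ} (hE : 0 < Metric.infEDist E S) :
    ∃ δ > 0, Disjoint (Metric.ball E δ) S := by
  obtain ⟨r, hr0, hr⟩ := ENNReal.lt_iff_exists_nnreal_btwn.1 hE
  refine ⟨r, by exact_mod_cast hr0, Set.disjoint_left.2 fun t ht hS => ?_⟩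
  have h1 := hr.trans_le (Metric.infEDist_le_edist_of_mem hS)
  rw [edist_comm, edist_nndist, ENNReal.coe_lt_coe] at h1
  rw [Metric.mem_ball, ← coe_nndist, NNReal.coe_lt_coe] at ht
  exact lt_asymm h1 ht

theorem sub_continuousProjection_mem (K : H →ₗ.[ℂ] H) (v : H) :
    v - continuousProjection K v ∈ purePointSubspace K := by
  have hc : CompleteSpace (purePointSubspace K) :=
    (Submodule.isClosed_topologicalClosure _).completeSpace_coe
  rw [continuousProjection, Submodule.starProjection_orthogonal_val, sub_sub_cancel]
  exact Submodule.starProjection_apply_mem _ _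

theorem norm_sub_continuousProjection_le (K : H →ₗ.[ℂ] H) (v : H) :
    ‖v - continuousProjection K v‖ ≤ ‖v‖ := by
  have hc : CompleteSpace (purePointSubspace K) :=
    (Submodule.isClosed_topologicalClosure _).completeSpace_coe
  rw [continuousProjection, Submodule.starProjection_orthogonal_val, sub_sub_cancel]
  exact Submodule.norm_starProjection_apply_le _ _

/-- `v - Π_c v` lies in the pure point subspace, which the spectral projection of an eigenvalue-free
ball around `E` annihilates. Only spectral values at distance at least `δ` from `E` contribute,
whence the bound `δ⁻¹`. -/
theorem exists_norm_resolvent_comp_le {K : H →ₗ.[ℂ] H} {P : ProjectionValuedMeasure H}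
    (hP : P.IsSpectralMeasureOf K) (hK : IsSelfAdjoint K) {E : ℝ}
    (hE : 0 < Metric.infEDist E (pointSpectrum K)) :
    ∃ C, 0 ≤ C ∧ ∀ z : ℂ, z.re = E → z.im ≠ 0 →
      ‖resolvent K z - resolvent K z ∘L continuousProjection K‖ ≤ C := by
  obtain ⟨δ, hδ, hd⟩ := exists_ball_disjoint_of_infEDist_pos hE
  refine ⟨δ⁻¹, by positivity, fun z hz hz' => ContinuousLinearMap.opNorm_le_bound _
    (by positivity) fun v => ?_⟩
  have hzr := mem_resolventSet_of_im_ne_zero hK hz'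
  have hball : MeasurableSet (Metric.ball E δ) := measurableSet_ball
  set w := v - continuousProjection K v with hw
  have e : (resolvent K z - resolvent K z ∘L continuousProjection K) v = resolvent K z w := by
    simp [hw]
  have h0 := hP.proj_eq_zero_of_mem_purePointSubspace hK hball hd
    (sub_continuousProjection_mem K v)
  have h1 := P.proj_add_proj_compl hball w
  rw [h0, zero_add] at h1
  have h2 := hP.mul_norm_resolvent_le hK hzr hball.compl hδ.le (fun t ht => ?_) h1
  · rw [e, inv_mul_eq_div, le_div_iff₀ hδ, mul_comm]
    exact h2.trans (norm_sub_continuousProjection_le K v)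
  · rw [Set.mem_compl_iff, Metric.mem_ball, not_lt, Real.dist_eq] at ht
    refine ht.trans ?_
    have := Complex.abs_re_le_norm ((t : ℂ) - z)
    rwa [Complex.sub_re, Complex.ofReal_re, hz] at this

/-- The weighted resolvent is bounded on the vertical line through `E`. -/
theorem exists_norm_weighted_resolvent_le {K : H →ₗ.[ℂ] H} {P : ProjectionValuedMeasure H}
    (hP : P.IsSpectralMeasureOf K) (hK : IsSelfAdjoint K) {E : ℝ}
    (hE : 0 < Metric.infEDist E (pointSpectrum K)) {A₁ A₂ B : H →L[ℂ] H}
    (hB : Function.Injective B) (h_lap : limitingAbsorptionSup K B E < ∞)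
    (hA₁ : IsBoundedMulInverse A₁ B) (hA₂ : IsBoundedInverseMul B A₂) :
    ∃ M, ∀ z : ℂ, z.re = E → z.im ≠ 0 → ‖A₁ ∘L resolvent K z ∘L A₂‖ ≤ M := by
  obtain ⟨C, hC0, hC⟩ := exists_norm_comp_comp_le hB hA₁ hA₂
  obtain ⟨D, hD0, hD⟩ := exists_norm_resolvent_comp_le hP hK hE
  refine ⟨C * (limitingAbsorptionSup K B E).toReal + ‖A₁‖ * (D * ‖A₂‖), fun z hz hz' => ?_⟩
  have e : A₁ ∘L resolvent K z ∘L A₂ =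
      A₁ ∘L (resolvent K z ∘L continuousProjection K) ∘L A₂ +
      A₁ ∘L (resolvent K z - resolvent K z ∘L continuousProjection K) ∘L A₂ := by
    ext v; simp
  rw [e]
  refine (norm_add_le _ _).trans (add_le_add ?_ ?_)
  · refine (hC _).trans (mul_le_mul_of_nonneg_left ?_ hC0)
    have h1 : ‖B ∘L resolvent K z ∘L continuousProjection K ∘L B‖ₑ ≤
        limitingAbsorptionSup K B E := le_iSup₂_of_le z ⟨hz, hz'⟩ le_rfl
    have h2 := ENNReal.toReal_mono h_lap.ne h1
    rwa [toReal_enorm] at h2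
  · refine (ContinuousLinearMap.opNorm_comp_le _ _).trans
      (mul_le_mul_of_nonneg_left ?_ (norm_nonneg _))
    exact (ContinuousLinearMap.opNorm_comp_le _ _).trans
      (mul_le_mul_of_nonneg_right (hD z hz hz') (norm_nonneg _))

theorem continuousOn_weighted_resolvent (K : H →ₗ.[ℂ] H) (A₁ A₂ : H →L[ℂ] H) :
    ContinuousOn (fun z => A₁ ∘L resolvent K z ∘L A₂) (resolventSet K) :=
  continuousOn_const.clm_comp ((continuousOn_resolvent K).clm_comp continuousOn_const)

theorem intervalIntegrable_of_continuousOn_compl_of_bound {F : Type*} [NormedAddCommGroup F]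
    {f : ℝ → F} {c : ℝ} (hf : ContinuousOn f {c}ᶜ) {M : ℝ} (hM : ∀ y, y ≠ c → ‖f y‖ ≤ M)
    (a b : ℝ) : IntervalIntegrable f volume a b := by
  have hae : ∀ᵐ y : ℝ, y ∈ ({c}ᶜ : Set ℝ) := by simp [ae_iff]
  have hm : AEStronglyMeasurable f volume := by
    have := hf.aestronglyMeasurable (μ := volume) (MeasurableSet.singleton c).compl
    rwa [Measure.restrict_eq_self_of_ae_mem hae] at this
  rw [intervalIntegrable_iff]
  refine Measure.integrableOn_of_bounded (M := M) (by simp [Set.uIoc]) hm ?_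
  filter_upwards [ae_restrict_of_ae hae] with y hy using hM y hy

theorem intervalIntegrable_weighted_resolvent_vertical {K : H →ₗ.[ℂ] H}
    {P : ProjectionValuedMeasure H}
    (hP : P.IsSpectralMeasureOf K) (hK : IsSelfAdjoint K) {E : ℝ}
    (hE : 0 < Metric.infEDist E (pointSpectrum K)) {A₁ A₂ B : H →L[ℂ] H}
    (hB : Function.Injective B) (h_lap : limitingAbsorptionSup K B E < ∞)
    (hA₁ : IsBoundedMulInverse A₁ B) (hA₂ : IsBoundedInverseMul B A₂) (a b : ℝ) :
    IntervalIntegrable (fun y : ℝ => A₁ ∘L resolvent K (E + y * Complex.I) ∘L A₂) volume a b := by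
  obtain ⟨M, hM⟩ := exists_norm_weighted_resolvent_le hP hK hE hB h_lap hA₁ hA₂
  refine intervalIntegrable_of_continuousOn_compl_of_bound (c := 0) (M := M) ?_ (fun y hy => ?_) a b
  · refine (continuousOn_weighted_resolvent K A₁ A₂).comp (by fun_prop) fun y hy => ?_
    exact mem_resolventSet_of_im_ne_zero hK (by simpa using hy)
  · exact hM _ (by simp) (by simpa using hy)

theorem continuous_weighted_resolvent_horizontal {K : H →ₗ.[ℂ] H} (hK : IsSelfAdjoint K)
    (A₁ A₂ : H →L[ℂ] H) {s : ℝ} (hs : s ≠ 0) :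
    Continuous fun x : ℝ => A₁ ∘L resolvent K (x + s * Complex.I) ∘L A₂ := by
  rw [← continuousOn_univ]
  refine (continuousOn_weighted_resolvent K A₁ A₂).comp (by fun_prop) fun x _ => ?_
  exact mem_resolventSet_of_im_ne_zero hK (by simpa using hs)

theorem continuous_weighted_resolvent_left {K : H →ₗ.[ℂ] H} (hK : IsSelfAdjoint K)
    (hb : IsBoundedBelow K) (A₁ A₂ : H →L[ℂ] H) {a : ℝ} (ha : a < sInf (realSpectrum K)) :
    Continuous fun y : ℝ => A₁ ∘L resolvent K (a + y * Complex.I) ∘L A₂ := by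
  rw [← continuousOn_univ]
  refine (continuousOn_weighted_resolvent K A₁ A₂).comp (by fun_prop) fun y _ => ?_
  exact mem_resolventSet_of_re_lt_sInf hK hb (by simpa using ha)

end Weighted

/-! ### The Cauchy kernel along the sides of a rectangle -/

section Kernel

open Filter Topology

/-- Pairing the two opposite sides leaves a Poisson kernel, whose primitive is an arctangent. -/
theorem integral_cauchyKernel_horizontal (t a b : ℝ) {s : ℝ} (hs : 0 < s) :
    ∫ x in a..b, (((t : ℂ) - (x - s * Complex.I))⁻¹ - ((t : ℂ) - (x + s * Complex.I))⁻¹) =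
      ((-2 * (Real.arctan ((b - t) / s) - Real.arctan ((a - t) / s)) : ℝ) : ℂ) * Complex.I := by
  have hpos : ∀ x : ℝ, 0 < (t - x) ^ 2 + s ^ 2 := fun x => by positivity
  have e : ∀ x : ℝ, ((t : ℂ) - (x - s * Complex.I))⁻¹ - ((t : ℂ) - (x + s * Complex.I))⁻¹ =
      ((-2 * (s / ((t - x) ^ 2 + s ^ 2)) : ℝ) : ℂ) * Complex.I := by
    intro x
    have h1 : (t : ℂ) - (x - s * Complex.I) ≠ 0 := fun h => by
      have := congrArg Complex.im h
      simp at this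
      exact hs.ne' this
    have h2 : (t : ℂ) - (x + s * Complex.I) ≠ 0 := fun h => by
      have := congrArg Complex.im h
      simp at this
      exact hs.ne' this
    have h3 : (((t - x) ^ 2 + s ^ 2 : ℝ) : ℂ) ≠ 0 := by exact_mod_cast (hpos x).ne'
    have h4 : (((t - x) ^ 2 + s ^ 2 : ℝ) : ℂ) =
        ((t : ℂ) - (x - s * Complex.I)) * ((t : ℂ) - (x + s * Complex.I)) := by
      push_cast
      linear_combination (s : ℂ) ^ 2 * Complex.I_sq
    rw [Complex.ofReal_mul, Complex.ofReal_div, h4]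
    field_simp
    push_cast
    ring
  have hd : ∀ x : ℝ, HasDerivAt (fun x : ℝ => -2 * Real.arctan ((x - t) / s))
      (-2 * (s / ((t - x) ^ 2 + s ^ 2))) x := by
    intro x
    have h := ((((hasDerivAt_id x).sub_const t).div_const s).arctan).const_mul (-2)
    refine h.congr_deriv ?_
    have h1 := (hpos x).ne'
    have h2 : 1 + ((x - t) / s) ^ 2 ≠ 0 := by positivity
    simp only [id]
    field_simp
    ring
  have hc : Continuous fun x : ℝ => -2 * (s / ((t - x) ^ 2 + s ^ 2)) :=
    continuous_const.mul (continuous_const.div (by fun_prop) fun x => (hpos x).ne')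
  simp only [e]
  rw [intervalIntegral.integral_mul_const, intervalIntegral.integral_ofReal,
    intervalIntegral.integral_eq_sub_of_hasDerivAt (fun x _ => hd x) (hc.intervalIntegrable _ _)]
  congr 2
  ring

/-- Pairing `y` with `-y` cancels the imaginary part. For `t = c` both sides vanish, the right one
because `q / 0 = 0`. -/
theorem integral_cauchyKernel_vertical (t c p q : ℝ) :
    ∫ y in p..q, (((t : ℂ) - (c + y * Complex.I))⁻¹ +
        ((t : ℂ) - (c + ((-y : ℝ) : ℂ) * Complex.I))⁻¹) =
      ((2 * (Real.arctan (q / (t - c)) - Real.arctan (p / (t - c))) : ℝ) : ℂ) := by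
  rcases eq_or_ne t c with rfl | htc
  · have e : ∀ y : ℝ, ((t : ℂ) - (t + y * Complex.I))⁻¹ +
        ((t : ℂ) - (t + ((-y : ℝ) : ℂ) * Complex.I))⁻¹ = 0 := by
      intro y
      have e1 : (t : ℂ) - (t + y * Complex.I) = -(y * Complex.I) := by ring
      have e2 : (t : ℂ) - (t + ((-y : ℝ) : ℂ) * Complex.I) = y * Complex.I := by push_cast; ring
      rw [e1, e2, inv_neg, neg_add_cancel]
    simp only [e]
    simp
  have htc' : t - c ≠ 0 := sub_ne_zero.2 htc
  have hpos : ∀ y : ℝ, 0 < (t - c) ^ 2 + y ^ 2 := fun y => by positivity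
  have e : ∀ y : ℝ, ((t : ℂ) - (c + y * Complex.I))⁻¹ +
      ((t : ℂ) - (c + ((-y : ℝ) : ℂ) * Complex.I))⁻¹ =
      ((2 * ((t - c) / ((t - c) ^ 2 + y ^ 2)) : ℝ) : ℂ) := by
    intro y
    have h1 : (t : ℂ) - (c + y * Complex.I) ≠ 0 := fun h => by
      have := congrArg Complex.re h
      simp at this
      exact htc' this
    have e2 : (t : ℂ) - (c + ((-y : ℝ) : ℂ) * Complex.I) = (t : ℂ) - (c - y * Complex.I) := by
      push_cast; ring
    have h2 : (t : ℂ) - (c - y * Complex.I) ≠ 0 := fun h => by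
      have := congrArg Complex.re h
      simp at this
      exact htc' this
    have h4 : (((t - c) ^ 2 + y ^ 2 : ℝ) : ℂ) =
        ((t : ℂ) - (c + y * Complex.I)) * ((t : ℂ) - (c - y * Complex.I)) := by
      push_cast
      linear_combination (y : ℂ) ^ 2 * Complex.I_sq
    rw [Complex.ofReal_mul, Complex.ofReal_div, h4, e2]
    field_simp
    push_cast
    ring
  have hd : ∀ y : ℝ, HasDerivAt (fun y : ℝ => 2 * Real.arctan (y / (t - c)))
      (2 * ((t - c) / ((t - c) ^ 2 + y ^ 2))) y := by
    intro y
    have h := (((hasDerivAt_id y).div_const (t - c)).arctan).const_mul 2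
    refine h.congr_deriv ?_
    have h1 := (hpos y).ne'
    have h2 : 1 + (y / (t - c)) ^ 2 ≠ 0 := by positivity
    simp only [id]
    field_simp
  have hc : Continuous fun y : ℝ => 2 * ((t - c) / ((t - c) ^ 2 + y ^ 2)) :=
    continuous_const.mul (continuous_const.div (by fun_prop) fun y => (hpos y).ne')
  simp only [e]
  rw [intervalIntegral.integral_ofReal,
    intervalIntegral.integral_eq_sub_of_hasDerivAt (fun y _ => hd y) (hc.intervalIntegrable _ _)]
  congr 1
  ring

theorem arctan_div_add_arctan_div {x y : ℝ} (hx : 0 < x) (hy : 0 < y) :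
    Real.arctan (x / y) + Real.arctan (y / x) = Real.pi / 2 := by
  rw [← inv_div y x, Real.arctan_inv_of_pos (div_pos hy hx)]
  ring

/-- The integral of the Cauchy kernel `(t - z)⁻¹` along the boundary of the rectangle, with the
part `|Im z| < ε` of the side `Re z = E` removed. -/
theorem cauchyKernel_truncated {t a E s ε : ℝ} (hs : 0 < s) (hta : a < t) (htE : t ≠ E) :
    ((-2 * (Real.arctan ((E - t) / s) - Real.arctan ((a - t) / s)) : ℝ) : ℂ) * Complex.I +
      Complex.I * ((2 * (Real.arctan (s / (t - E)) - Real.arctan (ε / (t - E))) : ℝ) : ℂ) -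
      Complex.I * ((2 * (Real.arctan (s / (t - a)) - Real.arctan (0 / (t - a))) : ℝ) : ℂ) =
    -(2 * Real.pi * Complex.I) * (((Set.Iio E).indicator (fun _ => (1 : ℝ)) t : ℝ) : ℂ) -
      2 * Complex.I * ((Real.arctan (ε / (t - E)) : ℝ) : ℂ) := by
  have h1 := arctan_div_add_arctan_div (sub_pos.2 hta) hs
  have h2 : Real.arctan ((a - t) / s) = -Real.arctan ((t - a) / s) := by
    rw [← Real.arctan_neg]; congr 1; ring
  -- The jump at `E`: reciprocal arctangents add to `±π/2` according to the sign of `t - E`. No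
  -- order between `a` and `E` is involved, so degenerate or reversed rectangles are covered.
  have h3 : -Real.arctan ((E - t) / s) + Real.arctan (s / (t - E)) =
      Real.pi / 2 - Real.pi * (Set.Iio E).indicator (fun _ => (1 : ℝ)) t := by
    rcases lt_or_gt_of_ne htE with h | h
    · have h4 := arctan_div_add_arctan_div (sub_pos.2 h) hs
      have h5 : Real.arctan (s / (t - E)) = -Real.arctan (s / (E - t)) := by
        rw [← Real.arctan_neg, ← div_neg, neg_sub]
      rw [Set.indicator_of_mem (Set.mem_Iio.2 h), h5]
      linarith
    · have h4 := arctan_div_add_arctan_div (sub_pos.2 h) hs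
      have h5 : Real.arctan ((E - t) / s) = -Real.arctan ((t - E) / s) := by
        rw [← Real.arctan_neg]; congr 1; ring
      rw [Set.indicator_of_notMem (by simpa using h.le), h5]
      linarith
  rw [h2, zero_div, Real.arctan_zero, sub_zero]
  have h1' := congrArg (fun r : ℝ => (r : ℂ)) h1
  have h3' := congrArg (fun r : ℝ => (r : ℂ)) h3
  push_cast at h1' h3' ⊢
  linear_combination 2 * Complex.I * h3' - 2 * Complex.I * h1'

theorem tendsto_integral_arctan_div (μ : Measure ℝ) [IsFiniteMeasure μ] (E : ℝ) :
    Tendsto (fun ε : ℝ => ∫ t, ((Real.arctan (ε / (t - E)) : ℝ) : ℂ) ∂μ) (𝓝[>] 0) (𝓝 0) := by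
  have h : Tendsto (fun ε : ℝ => ∫ t, ((Real.arctan (ε / (t - E)) : ℝ) : ℂ) ∂μ) (𝓝[>] 0)
      (𝓝 (∫ _, (0 : ℂ) ∂μ)) := by
    refine tendsto_integral_filter_of_dominated_convergence (fun _ => Real.pi / 2)
      (Eventually.of_forall fun ε => ?_) (Eventually.of_forall fun ε => Eventually.of_forall
        fun t => ?_) (integrable_const _) (Eventually.of_forall fun t => ?_)
    · exact (Complex.measurable_ofReal.comp
        (Real.measurable_arctan.comp (by fun_prop))).aestronglyMeasurable
    · rw [Complex.norm_real, Real.norm_eq_abs]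
      exact abs_le.2 ⟨(Real.neg_pi_div_two_lt_arctan _).le, (Real.arctan_lt_pi_div_two _).le⟩
    · have hc : Continuous fun ε : ℝ => ((Real.arctan (ε / (t - E)) : ℝ) : ℂ) :=
        Complex.continuous_ofReal.comp (Real.continuous_arctan.comp (continuous_id.div_const _))
      have := hc.tendsto 0
      simp only [zero_div, Real.arctan_zero, Complex.ofReal_zero] at this
      exact this.mono_left nhdsWithin_le_nhds
  simpa using h

end Kernel

/-! ### The contour integral -/

section Contour

open Filter Topology

/-- The quadratic form `T ↦ ⟪v, T v⟫` of operators, as a continuous linear map. -/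
def quadraticFormCLM (v : H) : (H →L[ℂ] H) →L[ℂ] ℂ :=
  (innerSL ℂ v).comp (ContinuousLinearMap.apply ℂ H v)

theorem quadraticFormCLM_apply (v : H) (T : H →L[ℂ] H) : quadraticFormCLM v T = ⟪v, T v⟫_ℂ := rfl

/-- The map `T ↦ A₁ T A₂`, as a continuous linear map. -/
def sandwichCLM (A₁ A₂ : H →L[ℂ] H) : (H →L[ℂ] H) →L[ℂ] H →L[ℂ] H :=
  (ContinuousLinearMap.compL ℂ H H H A₁).comp ((ContinuousLinearMap.compL ℂ H H H).flip A₂)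

theorem sandwichCLM_apply (A₁ A₂ T : H →L[ℂ] H) : sandwichCLM A₁ A₂ T = A₁ ∘L T ∘L A₂ := rfl

variable [CompleteSpace H]

/-- Fubini for a bounded kernel on a product of finite measures; the bound is needed only for `t` in
a set of full measure. -/
theorem inner_intervalIntegral_self {F : ℝ → H →L[ℂ] H} {k : ℝ → ℝ → ℂ} {p q : ℝ}
    {μ : Measure ℝ} [IsFiniteMeasure μ] {v : H} (hF : IntervalIntegrable F volume p q)
    (hk : ∀ x ∈ Set.uIcc p q, ⟪v, F x v⟫_ℂ = ∫ t, k x t ∂μ)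
    (hkm : Measurable (Function.uncurry k)) {S : Set ℝ} (hS : ∀ᵐ t ∂μ, t ∈ S) {M : ℝ}
    (hM : ∀ x ∈ Set.uIcc p q, ∀ t ∈ S, ‖k x t‖ ≤ M) :
    ⟪v, (∫ x in p..q, F x) v⟫_ℂ = ∫ t, (∫ x in p..q, k x t) ∂μ := by
  rw [← quadraticFormCLM_apply, ← ContinuousLinearMap.intervalIntegral_comp_comm _ hF,
    ← intervalIntegral_integral_swap]
  · exact intervalIntegral.integral_congr hk
  · have : IsFiniteMeasure (volume.restrict (Set.uIoc p q)) := ⟨by simp [Set.uIoc]⟩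
    refine Integrable.of_bound hkm.aestronglyMeasurable M ?_
    have h1 : ∀ᵐ x ∂(volume.restrict (Set.uIoc p q)), x ∈ Set.uIoc p q :=
      ae_restrict_mem measurableSet_uIoc
    have h2 := (Measure.quasiMeasurePreserving_fst (μ := volume.restrict (Set.uIoc p q))
      (ν := μ)).ae h1
    have h3 := (Measure.quasiMeasurePreserving_snd (μ := volume.restrict (Set.uIoc p q))
      (ν := μ)).ae hS
    filter_upwards [h2, h3] with y hy hy'
    exact hM _ (Set.uIoc_subset_uIcc hy) _ hy'

/-- The integral of the resolvent along the boundary of the rectangle, with the part `|Im z| < ε`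
of the side `Re z = E` removed. -/
def truncatedContour (K : H →ₗ.[ℂ] H) (a E s ε : ℝ) : H →L[ℂ] H :=
  (∫ x : ℝ in a..E,
    (resolvent K (x - s * Complex.I) - resolvent K (x + s * Complex.I))) +
  Complex.I • (∫ y : ℝ in ε..s,
    (resolvent K (E + y * Complex.I) + resolvent K (E + ((-y : ℝ) : ℂ) * Complex.I))) -
  Complex.I • (∫ y : ℝ in (0 : ℝ)..s,
    (resolvent K (a + y * Complex.I) + resolvent K (a + ((-y : ℝ) : ℂ) * Complex.I)))

variable {K : H →ₗ.[ℂ] H} {P : ProjectionValuedMeasure H} {a E s ε : ℝ}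

theorem continuousOn_resolvent_comp {φ : ℝ → ℂ} (hφ : Continuous φ) {S : Set ℝ}
    (h : ∀ x ∈ S, φ x ∈ resolventSet K) : ContinuousOn (fun x => resolvent K (φ x)) S :=
  (continuousOn_resolvent K).comp hφ.continuousOn h

theorem norm_inv_le_of_le_abs_im {w : ℂ} {d : ℝ} (hd : 0 < d) (h : d ≤ |w.im|) :
    ‖w⁻¹‖ ≤ d⁻¹ := by
  rw [norm_inv]
  exact inv_anti₀ hd (h.trans (Complex.abs_im_le_norm w))

theorem norm_inv_le_of_le_abs_re {w : ℂ} {d : ℝ} (hd : 0 < d) (h : d ≤ |w.re|) :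
    ‖w⁻¹‖ ≤ d⁻¹ := by
  rw [norm_inv]
  exact inv_anti₀ hd (h.trans (Complex.abs_re_le_norm w))

theorem integrable_inv_sub {z : ℂ} {μ : Measure ℝ} [IsFiniteMeasure μ] {S : Set ℝ}
    (hS : ∀ᵐ t ∂μ, t ∈ S) {M : ℝ} (hM : ∀ t ∈ S, ‖((t : ℂ) - z)⁻¹‖ ≤ M) :
    Integrable (fun t : ℝ => ((t : ℂ) - z)⁻¹) μ := by
  refine Integrable.of_bound (by fun_prop) M ?_
  filter_upwards [hS] with t ht using hM t ht

/-- The quadratic form of the integral of a sum of two resolvents along curves on which the Cauchy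
kernel is bounded. -/
theorem inner_integral_resolvent_add (hP : P.IsSpectralMeasureOf K) (hK : IsSelfAdjoint K)
    {φ ψ : ℝ → ℂ} (hφ : Continuous φ) (hψ : Continuous ψ) {p q : ℝ} (c : ℂ)
    (hφr : ∀ x ∈ Set.uIcc p q, φ x ∈ resolventSet K)
    (hψr : ∀ x ∈ Set.uIcc p q, ψ x ∈ resolventSet K) {v : H} {S : Set ℝ}
    (hS : ∀ᵐ t ∂(P.scalarMeasure v), t ∈ S) {M : ℝ}
    (hφM : ∀ x ∈ Set.uIcc p q, ∀ t ∈ S, ‖((t : ℂ) - φ x)⁻¹‖ ≤ M)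
    (hψM : ∀ x ∈ Set.uIcc p q, ∀ t ∈ S, ‖((t : ℂ) - ψ x)⁻¹‖ ≤ M) :
    ⟪v, (∫ x in p..q, (resolvent K (φ x) + c • resolvent K (ψ x))) v⟫_ℂ =
      ∫ t, (∫ x in p..q, (((t : ℂ) - φ x)⁻¹ + c * ((t : ℂ) - ψ x)⁻¹)) ∂(P.scalarMeasure v) := by
  refine inner_intervalIntegral_self (k := fun x t => ((t : ℂ) - φ x)⁻¹ + c * ((t : ℂ) - ψ x)⁻¹)
    ?_ (fun x hx => ?_) ?_ hS (M := M + ‖c‖ * M) fun x hx t ht => ?_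
  · exact ((continuousOn_resolvent_comp hφ hφr).add
      ((continuousOn_resolvent_comp hψ hψr).const_smul c)).intervalIntegrable
  · rw [add_apply, smul_apply, inner_add_right, inner_smul_right,
      hP.inner_resolvent_self hK (hφr x hx), hP.inner_resolvent_self hK (hψr x hx),
      integral_add (integrable_inv_sub hS (hφM x hx))
        ((integrable_inv_sub hS (hψM x hx)).const_mul c), integral_const_mul]
  · have h1 := hφ.measurable
    have h2 := hψ.measurable
    simp only [Function.uncurry_def]
    fun_prop
  · refine (norm_add_le _ _).trans (add_le_add (hφM x hx t ht) ?_)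
    rw [norm_mul]
    exact mul_le_mul_of_nonneg_left (hψM x hx t ht) (norm_nonneg _)

/-- Each pair of sides stays away from the support of `μ_v`: the horizontal ones by `s`, the cut
side at `E` by `ε`, the left one by `m - a`. Fubini thus applies to each, and the scalar kernel
identity finishes pointwise. -/
theorem inner_truncatedContour (hP : P.IsSpectralMeasureOf K) (hK : IsSelfAdjoint K)
    (hb : IsBoundedBelow K) (ha : a < sInf (realSpectrum K)) (hE : E ∉ pointSpectrum K)
    (hε : 0 < ε) (hεs : ε ≤ s) (v : H) :
    ⟪v, truncatedContour K a E s ε v⟫_ℂ =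
      -(2 * Real.pi * Complex.I) * ⟪v, P.proj (Set.Iio E) v⟫_ℂ -
        2 * Complex.I * ∫ t, ((Real.arctan (ε / (t - E)) : ℝ) : ℂ) ∂(P.scalarMeasure v) := by
  have hs : 0 < s := hε.trans_le hεs
  set m := sInf (realSpectrum K)
  set μ := P.scalarMeasure v with hμ
  have hS : ∀ᵐ t ∂μ, t ∈ Set.Ici m := by
    rw [ae_iff]
    have := hP.scalarMeasure_Iio_eq_zero hK hb v
    simpa [Set.Iio] using this
  -- Here the absence of an eigenvalue at `E` enters; the kernel identity is stated for `t ≠ E`.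
  have hSE : ∀ᵐ t ∂μ, t ≠ E := by
    rw [ae_iff]
    have := (P.proj_eq_zero_iff (MeasurableSet.singleton E) v).1 (hP.proj_singleton_eq_zero hK hE v)
    simpa using this
  have e1 := inner_integral_resolvent_add hP hK (v := v) (p := a) (q := E) (M := s⁻¹)
    (φ := fun x => x - s * Complex.I) (ψ := fun x => x + s * Complex.I) (by fun_prop)
    (by fun_prop) (-1) (fun x _ => mem_resolventSet_of_im_ne_zero hK (by simp [hs.ne']))
    (fun x _ => mem_resolventSet_of_im_ne_zero hK (by simp [hs.ne'])) hS
    (fun x _ t _ => norm_inv_le_of_le_abs_im hs (by simp [abs_of_pos hs]))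
    (fun x _ t _ => norm_inv_le_of_le_abs_im hs (by simp [abs_of_pos hs]))
  have e2 := inner_integral_resolvent_add hP hK (v := v) (p := ε) (q := s) (M := ε⁻¹)
    (φ := fun y => E + y * Complex.I) (ψ := fun y => E + ((-y : ℝ) : ℂ) * Complex.I) (by fun_prop)
    (by fun_prop) 1
    (fun y hy => mem_resolventSet_of_im_ne_zero hK (by
      rw [Set.uIcc_of_le hεs] at hy
      simpa using (hε.trans_le hy.1).ne'))
    (fun y hy => mem_resolventSet_of_im_ne_zero hK (by
      rw [Set.uIcc_of_le hεs] at hy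
      simpa using (hε.trans_le hy.1).ne')) hS
    (fun y hy t _ => norm_inv_le_of_le_abs_im hε (by
      rw [Set.uIcc_of_le hεs] at hy
      simpa using hy.1.trans (le_abs_self y)))
    (fun y hy t _ => norm_inv_le_of_le_abs_im hε (by
      rw [Set.uIcc_of_le hεs] at hy
      simpa using hy.1.trans (le_abs_self y)))
  have e3 := inner_integral_resolvent_add hP hK (v := v) (p := 0) (q := s) (M := (m - a)⁻¹)
    (φ := fun y => a + y * Complex.I) (ψ := fun y => a + ((-y : ℝ) : ℂ) * Complex.I) (by fun_prop)
    (by fun_prop) 1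
    (fun y _ => mem_resolventSet_of_re_lt_sInf hK hb (by simpa using ha))
    (fun y _ => mem_resolventSet_of_re_lt_sInf hK hb (by simpa using ha)) hS
    (fun y _ t ht => norm_inv_le_of_le_abs_re (sub_pos.2 ha) (by
      simpa using (sub_le_sub_right (Set.mem_Ici.1 ht) a).trans (le_abs_self (t - a))))
    (fun y _ t ht => norm_inv_le_of_le_abs_re (sub_pos.2 ha) (by
      simpa using (sub_le_sub_right (Set.mem_Ici.1 ht) a).trans (le_abs_self (t - a))))
  simp only [neg_smul, one_smul, neg_mul, one_mul, ← sub_eq_add_neg] at e1 e2 e3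
  simp only [integral_cauchyKernel_horizontal _ _ _ hs, integral_cauchyKernel_vertical] at e1 e2 e3
  rw [← hμ] at e1 e2 e3
  have hA : Measurable Real.arctan := Real.measurable_arctan
  have hbd : ∀ x : ℝ, |Real.arctan x| ≤ 2 := fun x => by
    have h1 := Real.neg_pi_div_two_lt_arctan x
    have h2 := Real.arctan_lt_pi_div_two x
    have h3 := Real.pi_le_four
    exact abs_le.2 ⟨by linarith, by linarith⟩
  have hint : ∀ f g : ℝ → ℝ, Measurable f → Measurable g → ∀ c : ℝ, Integrable
      (fun t => ((c * (Real.arctan (f t) - Real.arctan (g t)) : ℝ) : ℂ)) μ := by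
    intro f g hf hg c
    refine Integrable.of_bound (C := |c| * 4) (Complex.measurable_ofReal.comp
      (((hA.comp hf).sub (hA.comp hg)).const_mul c)).aestronglyMeasurable
      (Eventually.of_forall fun t => ?_)
    rw [Complex.norm_real, Real.norm_eq_abs, abs_mul]
    refine mul_le_mul_of_nonneg_left ((abs_sub _ _).trans ?_) (abs_nonneg c)
    linarith [hbd (f t), hbd (g t)]
  have i1 := (hint (fun t => (E - t) / s) (fun t => (a - t) / s) (by fun_prop) (by fun_prop)
    (-2)).mul_const Complex.I
  have i2 := (hint (fun t => s / (t - E)) (fun t => ε / (t - E)) (by fun_prop) (by fun_prop)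
    2).const_mul Complex.I
  have i3 := (hint (fun t => s / (t - a)) (fun t => 0 / (t - a)) (by fun_prop) (by fun_prop)
    2).const_mul Complex.I
  have i12 : Integrable (fun t =>
      ((-2 * (Real.arctan ((E - t) / s) - Real.arctan ((a - t) / s)) : ℝ) : ℂ) * Complex.I +
      Complex.I * ((2 * (Real.arctan (s / (t - E)) - Real.arctan (ε / (t - E))) : ℝ) : ℂ)) μ :=
    i1.add i2
  have i4 : Integrable (fun t => ((Real.arctan (ε / (t - E)) : ℝ) : ℂ)) μ := by
    have := hint (fun t => ε / (t - E)) (fun _ => 0) (by fun_prop) (by fun_prop) 1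
    simpa only [Real.arctan_zero, sub_zero, one_mul] using this
  have i5 : Integrable (fun t => (((Set.Iio E).indicator (fun _ => (1 : ℝ)) t : ℝ) : ℂ)) μ :=
    ((integrable_const (1 : ℝ)).indicator measurableSet_Iio).ofReal
  have hproj : ⟪v, P.proj (Set.Iio E) v⟫_ℂ =
      ∫ t, (((Set.Iio E).indicator (fun _ => (1 : ℝ)) t : ℝ) : ℂ) ∂μ := by
    have h1 : ⟪v, P.proj (Set.Iio E) v⟫_ℂ =
        ⟪P.proj (Set.Iio E) v, P.proj (Set.Iio E) v⟫_ℂ := by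
      rw [P.inner_proj_left measurableSet_Iio, P.proj_proj measurableSet_Iio measurableSet_Iio,
        Set.inter_self]
    rw [integral_complex_ofReal, integral_indicator_const _ measurableSet_Iio,
      P.scalarMeasure_real measurableSet_Iio, h1, inner_self_eq_norm_sq_to_K]
    simp
  rw [truncatedContour, sub_apply, add_apply, smul_apply, smul_apply, inner_sub_right,
    inner_add_right, inner_smul_right, inner_smul_right, e1, e2, e3, ← integral_const_mul,
    ← integral_const_mul, ← integral_add i1 i2, ← integral_sub i12 i3, hproj,
    ← integral_const_mul, ← integral_const_mul, ← integral_sub (i5.const_mul _) (i4.const_mul _)]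
  refine integral_congr_ae ?_
  filter_upwards [hS, hSE] with t ht htE
  exact cauchyKernel_truncated hs (ha.trans_le ht) htE

theorem tendsto_inner_truncatedContour (hP : P.IsSpectralMeasureOf K) (hK : IsSelfAdjoint K)
    (hb : IsBoundedBelow K) (ha : a < sInf (realSpectrum K)) (hE : E ∉ pointSpectrum K)
    (hs : 0 < s) (u v : H) :
    Tendsto (fun ε => ⟪truncatedContour K a E s ε u, v⟫_ℂ) (𝓝[>] 0)
      (𝓝 ⟪(-(2 * Real.pi * Complex.I) • P.proj (Set.Iio E)) u, v⟫_ℂ) := by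
  rw [inner_eq_polarForm]
  refine tendsto_inner_of_tendsto_inner_self (fun v => ?_) u v
  have h := ((tendsto_integral_arctan_div (P.scalarMeasure v) E).const_mul
    (2 * Complex.I)).const_sub (-(2 * Real.pi * Complex.I) * ⟪v, P.proj (Set.Iio E) v⟫_ℂ)
  rw [mul_zero, sub_zero, ← inner_smul_right, ← smul_apply] at h
  have h2 : Tendsto (fun ε => ⟪v, truncatedContour K a E s ε v⟫_ℂ) (𝓝[>] 0)
      (𝓝 ⟪v, (-(2 * Real.pi * Complex.I) • P.proj (Set.Iio E)) v⟫_ℂ) := by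
    refine h.congr' ?_
    filter_upwards [Ioc_mem_nhdsGT hs] with ε hε
    rw [inner_truncatedContour hP hK hb ha hE hε.1 hε.2, smul_apply, inner_smul_right]
  simpa only [Function.comp_def, inner_conj_symm] using
    (Complex.continuous_conj.tendsto _).comp h2

theorem intervalIntegrable_comp_neg {F : Type*} [NormedAddCommGroup F] {f : ℝ → F}
    (hf : ∀ p q, IntervalIntegrable f volume p q) (p q : ℝ) :
    IntervalIntegrable (fun y => f (-y)) volume p q := by
  have := (hf (-p) (-q)).comp_mul_left (c := -1)
  simpa using this

theorem integral_add_comp_neg {F : Type*} [NormedAddCommGroup F] [NormedSpace ℝ F]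
    {f : ℝ → F} (hf : ∀ p q, IntervalIntegrable f volume p q) (s : ℝ) :
    ∫ y in (0 : ℝ)..s, (f y + f (-y)) = ∫ y in (-s)..s, f y := by
  rw [intervalIntegral.integral_add (hf _ _) (intervalIntegrable_comp_neg hf _ _),
    intervalIntegral.integral_comp_neg, neg_zero, add_comm,
    intervalIntegral.integral_add_adjacent_intervals (hf _ _) (hf _ _)]

theorem tendsto_integral_add_comp_neg {F : Type*} [NormedAddCommGroup F] [NormedSpace ℝ F]
    {f : ℝ → F} (hf : ∀ p q, IntervalIntegrable f volume p q) (s : ℝ) :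
    Tendsto (fun ε => ∫ y in ε..s, (f y + f (-y))) (𝓝[>] 0) (𝓝 (∫ y in (-s)..s, f y)) := by
  have hc : Continuous fun ε => ∫ y in ε..s, (f y + f (-y)) :=
    (intervalIntegral.continuous_primitive
      (fun p q => (hf p q).add (intervalIntegrable_comp_neg hf p q)) s).neg.congr
      fun ε => (intervalIntegral.integral_symm s ε).symm
  rw [← integral_add_comp_neg hf]
  exact (hc.tendsto 0).mono_left nhdsWithin_le_nhds

theorem clm_intervalIntegral_add {F G : Type*} [NormedAddCommGroup F] [NormedSpace ℂ F]
    [CompleteSpace F] [NormedAddCommGroup G] [NormedSpace ℂ G] [CompleteSpace G] (L : F →L[ℂ] G)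
    {f g : ℝ → F} {p q : ℝ} (hf : IntervalIntegrable f volume p q)
    (hg : IntervalIntegrable g volume p q) :
    L (∫ x in p..q, (f x + g x)) = ∫ x in p..q, (L (f x) + L (g x)) := by
  simp only [← map_add]
  exact (L.intervalIntegral_comp_comm (hf.add hg)).symm

theorem clm_intervalIntegral_sub {F G : Type*} [NormedAddCommGroup F] [NormedSpace ℂ F]
    [CompleteSpace F] [NormedAddCommGroup G] [NormedSpace ℂ G] [CompleteSpace G] (L : F →L[ℂ] G)
    {f g : ℝ → F} {p q : ℝ} (hf : IntervalIntegrable f volume p q)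
    (hg : IntervalIntegrable g volume p q) :
    L (∫ x in p..q, (f x - g x)) = (∫ x in p..q, L (f x)) - ∫ x in p..q, L (g x) := by
  rw [intervalIntegral.integral_sub hf hg, map_sub, L.intervalIntegral_comp_comm hf,
    L.intervalIntegral_comp_comm hg]

/-- Only the side through `E` depends on `ε`. Once weighted, its integrand is integrable across the
real axis, so the integral is continuous in `ε` down to `0`, in operator norm. -/
theorem tendsto_sandwich_truncatedContour (hK : IsSelfAdjoint K) (hb : IsBoundedBelow K)
    (ha : a < sInf (realSpectrum K)) (hs : 0 < s) (A₁ A₂ : H →L[ℂ] H)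
    (hint : ∀ p q, IntervalIntegrable
      (fun y : ℝ => A₁ ∘L resolvent K (E + y * Complex.I) ∘L A₂) volume p q) :
    Tendsto (fun ε => A₁ ∘L truncatedContour K a E s ε ∘L A₂) (𝓝[>] 0)
      (𝓝 (rectContourIntegral (fun z => A₁ ∘L resolvent K z ∘L A₂) a E s)) := by
  set L := sandwichCLM A₁ A₂ with hL
  have hhor : ∀ r : ℝ, r ≠ 0 → Continuous fun x : ℝ => resolvent K (x + r * Complex.I) := by
    intro r hr
    rw [← continuousOn_univ]
    exact continuousOn_resolvent_comp (by fun_prop) fun x _ =>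
      mem_resolventSet_of_im_ne_zero hK (by simpa using hr)
  have hhor' : Continuous fun x : ℝ => resolvent K (x - s * Complex.I) := by
    have := hhor (-s) (neg_ne_zero.2 hs.ne')
    simpa [sub_eq_add_neg] using this
  have hleft : Continuous fun y : ℝ => resolvent K (a + y * Complex.I) := by
    rw [← continuousOn_univ]
    exact continuousOn_resolvent_comp (by fun_prop) fun y _ =>
      mem_resolventSet_of_re_lt_sInf hK hb (by simpa using ha)
  have hleft' : Continuous fun y : ℝ => resolvent K (a + ((-y : ℝ) : ℂ) * Complex.I) :=
    hleft.comp continuous_neg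
  have h1 : L (∫ x : ℝ in a..E,
      (resolvent K (x - s * Complex.I) - resolvent K (x + s * Complex.I))) =
      (∫ x : ℝ in a..E, L (resolvent K (x - s * Complex.I))) -
        ∫ x : ℝ in a..E, L (resolvent K (x + s * Complex.I)) :=
    clm_intervalIntegral_sub L (hhor'.intervalIntegrable _ _)
      ((hhor s hs.ne').intervalIntegrable _ _)
  have h3 : L (∫ y : ℝ in (0 : ℝ)..s,
      (resolvent K (a + y * Complex.I) + resolvent K (a + ((-y : ℝ) : ℂ) * Complex.I))) =
      ∫ y : ℝ in (-s)..s, L (resolvent K (a + y * Complex.I)) := by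
    rw [clm_intervalIntegral_add L (hleft.intervalIntegrable _ _) (hleft'.intervalIntegrable _ _)]
    exact integral_add_comp_neg (f := fun y : ℝ => L (resolvent K (a + y * Complex.I)))
      (fun p q => (L.continuous.comp hleft).intervalIntegrable p q) s
  have h2 : Tendsto (fun ε => L (∫ y : ℝ in ε..s,
      (resolvent K (E + y * Complex.I) + resolvent K (E + ((-y : ℝ) : ℂ) * Complex.I))))
      (𝓝[>] 0) (𝓝 (∫ y : ℝ in (-s)..s, L (resolvent K (E + y * Complex.I)))) := by
    refine (tendsto_integral_add_comp_neg
      (f := fun y : ℝ => L (resolvent K (E + y * Complex.I))) hint s).congr' ?_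
    filter_upwards [Ioc_mem_nhdsGT hs] with ε hε
    have hvert : ∀ c : ℝ → ℝ, Continuous c → (∀ y, c y = 0 → y = 0) →
        ContinuousOn (fun y : ℝ => resolvent K (E + (c y : ℂ) * Complex.I)) (Set.uIcc ε s) := by
      intro c hc h0
      refine continuousOn_resolvent_comp (by fun_prop) fun y hy =>
        mem_resolventSet_of_im_ne_zero hK ?_
      rw [Set.uIcc_of_le hε.2] at hy
      have hy0 : y ≠ 0 := (hε.1.trans_le hy.1).ne'
      simpa using fun h => hy0 (h0 y h)
    exact (clm_intervalIntegral_add L (hvert _ continuous_id fun y h => h).intervalIntegrable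
      (hvert _ continuous_neg fun y h => neg_eq_zero.1 h).intervalIntegrable).symm
  have key := ((h2.const_smul Complex.I).const_add ((∫ x : ℝ in a..E,
    L (resolvent K (x - s * Complex.I))) - ∫ x : ℝ in a..E,
      L (resolvent K (x + s * Complex.I)))).sub_const
    (Complex.I • ∫ y : ℝ in (-s)..s, L (resolvent K (a + y * Complex.I)))
  have e : rectContourIntegral (fun z => A₁ ∘L resolvent K z ∘L A₂) a E s =
      (∫ x : ℝ in a..E, L (resolvent K (x - s * Complex.I))) -
      (∫ x : ℝ in a..E, L (resolvent K (x + s * Complex.I))) +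
      Complex.I • (∫ y : ℝ in (-s)..s, L (resolvent K (E + y * Complex.I))) -
      Complex.I • ∫ y : ℝ in (-s)..s, L (resolvent K (a + y * Complex.I)) := by
    simp only [rectContourIntegral, hL, sandwichCLM_apply]
    abel
  rw [e]
  refine key.congr fun ε => ?_
  rw [← sandwichCLM_apply, ← hL, truncatedContour, map_sub, map_add, map_smul, map_smul, h1, h3]

/-- The sandwiched truncated contours have a norm limit and, moving `A₁` across as its adjoint, a
weak limit; the two must agree. -/
theorem rectContourIntegral_weighted_resolvent (hP : P.IsSpectralMeasureOf K) (hK : IsSelfAdjoint K)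
    (hb : IsBoundedBelow K) (ha : a < sInf (realSpectrum K)) (hE : E ∉ pointSpectrum K)
    (hs : 0 < s) (A₁ A₂ : H →L[ℂ] H)
    (hint : ∀ p q, IntervalIntegrable
      (fun y : ℝ => A₁ ∘L resolvent K (E + y * Complex.I) ∘L A₂) volume p q) :
    rectContourIntegral (fun z => A₁ ∘L resolvent K z ∘L A₂) a E s =
      -(2 * Real.pi * Complex.I) • (A₁ ∘L P.proj (Set.Iio E) ∘L A₂) := by
  ext u
  refine ext_inner_right ℂ fun v => ?_
  have h1 := tendsto_sandwich_truncatedContour (E := E) hK hb ha hs A₁ A₂ hint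
  have h2 : Tendsto (fun ε => ⟪A₁ (truncatedContour K a E s ε (A₂ u)), v⟫_ℂ) (𝓝[>] 0)
      (𝓝 ⟪rectContourIntegral (fun z => A₁ ∘L resolvent K z ∘L A₂) a E s u, v⟫_ℂ) :=
    (((ContinuousLinearMap.apply ℂ H u).continuous.tendsto _).comp h1).inner tendsto_const_nhds
  have h3 := tendsto_inner_truncatedContour hP hK hb ha hE hs (A₂ u)
    (ContinuousLinearMap.adjoint A₁ v)
  simp only [ContinuousLinearMap.adjoint_inner_right] at h3
  rw [tendsto_nhds_unique h2 h3]
  simp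

end Contour

end UnboundedOp

end

theorem theoremA1 {H : Type*} [NormedAddCommGroup H] [InnerProductSpace ℂ H] [CompleteSpace H]
    (K : H →ₗ.[ℂ] H) (hK : IsSelfAdjoint K) (hK_below : UnboundedOp.IsBoundedBelow K)
    (E : ℝ)
    (B : H →L[ℂ] H) (hB_inj : Function.Injective B) (hB_dense : DenseRange B)
    (h_lap : UnboundedOp.limitingAbsorptionSup K B E < ∞)
    (A₁ A₂ : H →L[ℂ] H)
    (hA₁ : UnboundedOp.IsBoundedMulInverse A₁ B)
    (hA₂ : UnboundedOp.IsBoundedInverseMul B A₂)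
    (hE : 0 < Metric.infEDist E (UnboundedOp.pointSpectrum K))
    (s : ℝ) (hs : 0 < s) :
    UnboundedOp.RectContourIntegrable
        (fun z : ℂ => A₁ ∘L UnboundedOp.resolvent K z ∘L A₂)
        (-1 + sInf (UnboundedOp.realSpectrum K)) E s ∧
      A₁ ∘L UnboundedOp.spectralProjection K (Set.Iio E) ∘L A₂ =
        -(1 / (2 * (Real.pi : ℂ) * Complex.I)) •
          UnboundedOp.rectContourIntegral
            (fun z : ℂ => A₁ ∘L UnboundedOp.resolvent K z ∘L A₂)
            (-1 + sInf (UnboundedOp.realSpectrum K)) E s := by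
  set a := -1 + sInf (UnboundedOp.realSpectrum K) with ha_def
  have ha : a < sInf (UnboundedOp.realSpectrum K) := by rw [ha_def]; linarith
  have hex : ∃ P : UnboundedOp.ProjectionValuedMeasure H, P.IsSpectralMeasureOf K :=
    UnboundedOp.exists_isSpectralMeasureOf hK
      (UnboundedOp.ofReal_mem_resolventSet_of_lt_sInf hK hK_below ha)
  have hP := hex.choose_spec
  -- The same chosen spectral measure is used throughout, so uniqueness of spectral measures is not
  -- needed.
  have hproj : UnboundedOp.spectralProjection K (Set.Iio E) = hex.choose.proj (Set.Iio E) := by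
    rw [UnboundedOp.spectralProjection, dif_pos hex]
  have hE' : E ∉ UnboundedOp.pointSpectrum K := fun h => by
    rw [Metric.infEDist_zero_of_mem h] at hE
    exact lt_irrefl _ hE
  have hvert := UnboundedOp.intervalIntegrable_weighted_resolvent_vertical hP hK hE hB_inj h_lap
    hA₁ hA₂
  refine ⟨⟨?_, hvert _ _, ?_, ?_⟩, ?_⟩
  · have := UnboundedOp.continuous_weighted_resolvent_horizontal hK A₁ A₂ (neg_ne_zero.2 hs.ne')
    simp only [Complex.ofReal_neg, neg_mul, ← sub_eq_add_neg] at this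
    exact this.intervalIntegrable _ _
  · exact (UnboundedOp.continuous_weighted_resolvent_horizontal hK A₁ A₂
      hs.ne').intervalIntegrable _ _
  · exact (UnboundedOp.continuous_weighted_resolvent_left hK hK_below A₁ A₂
      ha).intervalIntegrable _ _
  · rw [UnboundedOp.rectContourIntegral_weighted_resolvent hP hK hK_below ha hE' hs A₁ A₂ hvert, hproj,
      smul_smul]
    have h : -(1 / (2 * (Real.pi : ℂ) * Complex.I)) * -(2 * Real.pi * Complex.I) = 1 := by
      rw [neg_mul_neg, one_div]
      exact inv_mul_cancel₀ Complex.two_pi_I_ne_zero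
    rw [h, one_smul]
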